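/- Let $K$ be a local field (a field complete with respect to a discrete valuation) whose residue field is perfect of characteristic $p>0$, and let $M/L/K$ be a tower of finite separable totally ramified extensions. Put $n=[L:K]$, $m=[M:L]$, $\nu=v_p(n)$, $\mu=v_p(m)$. For a finite separable totally ramified extension $F/E$ of local fields as above, of degree $d$ with $\kappa=v_p(d)$, and for uniformizers $\pi_E,\pi_F$, there is a unique series $\sum_{h\ge 0}a_hX^{h+d}$ whose coefficients are Teichmüller representatives of the residue field in $E$ and whose value at $\pi_F$ is $\pi_E$. For $0\le j\le\kappa$ put $\tilde\imath_j=\min\{h\ge 0: v_p(h+d)\le j,\ a_h\ne 0\}$ (and $\tilde\imath_j=\infty$ if there is no such $h$). The indices of inseparability of $F/E$ are defined by $i_\kappa=\tilde\imath_\kappa$ and $i_j=\min\{\tilde\imath_j,\ i_{j+1}+v_F(p)\}$ for $j=\kappa-1,\dots,0$, where $v_F$ is the normalized valuation of $F$ ($v_F(p)=\infty$ in characteristic $p$); they do not depend on the choice of the uniformizers. Let $i_j$ $(0\le j\le\nu)$, $i'_k$ $(0\le k\le\mu)$ and $i''_l$ $(0\le l\le\nu+\mu)$ be the indices of inseparability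 of $L/K$, $M/L$ and $M/K$ respectively, each family computed with arbitrary uniformizers. For $0\le l\le\nu+\mu$ let $\Omega_l=\{(j,k):0\le j\le\nu,\ 0\le k\le\mu,\ j+k=l\}$. Then for $0\le l\le\nu+\mu$ $$i''_l\ \ge\ \min\{\,m\,i_j+p^j\,i'_k:(j,k)\in\Omega_{l_0}\text{ for some }0\le l_0\le l\,\},$$ and equality holds if there is an $l_0$ with $0\le l_0\le l$ such that exactly one pair $(j,k)\in\Omega_{l_0}$ realizes this minimum. -/

import Mathlib

open scoped WithZero

noncomputable section

/-- `K`, with its given valuation, is a local field with perfect residue field of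
characteristic `p`: the valuation is normalized (its value group is all of `ℤ`, written
multiplicatively), `K` is complete, and the residue field is perfect of characteristic `p`. -/
structure IsLocalField (p : ℕ) (K : Type*) [Field K] [Valued K ℤᵐ⁰] : Prop where
  normalized : Function.Surjective (Valued.v : Valuation K ℤᵐ⁰)
  complete : CompleteSpace K
  charP : CharP (Valued.ResidueField K) p
  perfect : PerfectField (Valued.ResidueField K)

/-- `L / K` is totally ramified: the valuation of `L` is normalized and extends that of `K`
with ramification index `[L : K]`, i.e. `v_L(x) = [L : K] * v_K(x)` for `x` in `K`
(written multiplicatively). -/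
structure IsTotallyRamified (K L : Type*) [Field K] [Valued K ℤᵐ⁰] [Field L] [Valued L ℤᵐ⁰]
    [Algebra K L] : Prop where
  normalized : Function.Surjective (Valued.v : Valuation L ℤᵐ⁰)
  map_eq : ∀ x : K, (Valued.v (algebraMap K L x) : ℤᵐ⁰) = Valued.v x ^ Module.finrank K L

/-- `π` is a uniformizer of `K`: its normalized valuation is `1`, which is written
multiplicatively as `exp (-1)`. -/
def IsUnif {K : Type*} [Field K] [Valued K ℤᵐ⁰] (π : K) : Prop :=
  (Valued.v π : ℤᵐ⁰) = WithZero.exp (-1 : ℤ)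

/-- The normalized additive valuation of an integral element `x`:
`⊤` for `x = 0`, and `d` if `x` has multiplicative valuation `exp (-d)`, `d ≥ 0`. -/
def ordInt {K : Type*} [Field K] [Valued K ℤᵐ⁰] (x : K) : ℕ∞ :=
  open Classical in if x = 0 then ⊤ else ((-WithZero.log (Valued.v x : ℤᵐ⁰)).toNat : ℕ∞)

/-- The Teichmüller representatives in `K`: the values of a multiplicative section
of the residue map (such a section is unique when `K` is a local field with perfect residue
field of positive characteristic). -/
def teichmullerReps (K : Type*) [Field K] [Valued K ℤᵐ⁰] : Set K :=
  {x | ∃ τ : Valued.ResidueField K →* Valued.integer K,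
    (∀ a, IsLocalRing.residue (Valued.integer K) (τ a) = a) ∧ ∃ a, (τ a : K) = x}

/-- `a` is the coefficient sequence of a series `∑ a_h X ^ (h + n)`, `n = [L : K]`, with
Teichmüller coefficients, whose value at `πL` is `πK` (convergence in `L`). -/
def IsTeichmullerExpansion {K L : Type*} [Field K] [Valued K ℤᵐ⁰] [Field L] [Valued L ℤᵐ⁰]
    [Algebra K L] (πK : K) (πL : L) (a : ℕ → K) : Prop :=
  (∀ h, a h ∈ teichmullerReps K) ∧
    HasSum (fun h : ℕ => algebraMap K L (a h) * πL ^ (h + Module.finrank K L))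
      (algebraMap K L πK)

/-- `ĩ_j = min {h ≥ 0 : v_p(h + n) ≤ j, a_h ≠ 0}`, equal to `⊤` if there is no such `h`,
where `∑ a_h X ^ (h + n)` is the (unique) Teichmüller expansion of `πK` in terms of `πL`. -/
def indexTilde (p : ℕ) {K L : Type*} [Field K] [Valued K ℤᵐ⁰] [Field L] [Valued L ℤᵐ⁰]
    [Algebra K L] (πK : K) (πL : L) (j : ℕ) : ℕ∞ :=
  ⨅ h ∈ {h : ℕ | padicValNat p (h + Module.finrank K L) ≤ j ∧
    ∃ a : ℕ → K, IsTeichmullerExpansion πK πL a ∧ a h ≠ 0}, (h : ℕ∞)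

/-- Downward recursion: `downRec ν t e d` is the term of index `ν - d` of the sequence given by
`i_ν = t ν` and `i_j = min (t j) (i_{j+1} + e)`. -/
def downRec (ν : ℕ) (t : ℕ → ℕ∞) (e : ℕ∞) : ℕ → ℕ∞
  | 0 => t ν
  | d + 1 => min (t (ν - (d + 1))) (downRec ν t e d + e)

/-- The `j`-th index of inseparability `i_j` of `L / K` (for `0 ≤ j ≤ ν = v_p([L : K])`),
computed with the uniformizers `πK` and `πL`. -/
def indexInsep (p : ℕ) {K L : Type*} [Field K] [Valued K ℤᵐ⁰] [Field L] [Valued L ℤᵐ⁰]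
    [Algebra K L] (πK : K) (πL : L) (j : ℕ) : ℕ∞ :=
  downRec (padicValNat p (Module.finrank K L)) (indexTilde p πK πL) (ordInt (p : L))
    (padicValNat p (Module.finrank K L) - j)

/-- `i_ν = ĩ_ν`. -/
theorem indexInsep_top (p : ℕ) {K L : Type*} [Field K] [Valued K ℤᵐ⁰] [Field L] [Valued L ℤᵐ⁰]
    [Algebra K L] (πK : K) (πL : L) :
    indexInsep p πK πL (padicValNat p (Module.finrank K L)) =
      indexTilde p πK πL (padicValNat p (Module.finrank K L)) := by
  simp [indexInsep, downRec]

/-- `i_j = min {ĩ_j, i_{j+1} + v_L(p)}` for `j < ν`. -/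
theorem indexInsep_of_lt (p : ℕ) {K L : Type*} [Field K] [Valued K ℤᵐ⁰] [Field L]
    [Valued L ℤᵐ⁰] [Algebra K L] (πK : K) (πL : L) (j : ℕ)
    (hj : j < padicValNat p (Module.finrank K L)) :
    indexInsep p πK πL j =
      min (indexTilde p πK πL j) (indexInsep p πK πL (j + 1) + ordInt (p : L)) := by
  unfold indexInsep
  obtain ⟨d, hd⟩ : ∃ d, padicValNat p (Module.finrank K L) - j = d + 1 :=
    ⟨padicValNat p (Module.finrank K L) - j - 1, by omega⟩
  have h1 : padicValNat p (Module.finrank K L) - (j + 1) = d := by omega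
  have h2 : padicValNat p (Module.finrank K L) - (d + 1) = j := by omega
  rw [hd, h1]
  simp only [downRec, h2]

/-- `Ω_l`, the pairs `(j, k)` with `0 ≤ j ≤ ν`, `0 ≤ k ≤ μ` and `j + k = l`. -/
def pairsΩ (ν μ l : ℕ) : Set (ℕ × ℕ) :=
  {x | x.1 ≤ ν ∧ x.2 ≤ μ ∧ x.1 + x.2 = l}

/-- The minimum of `f` over the pairs that lie in `Ω_{l₀}` for some `l₀ ≤ l`. -/
def minUpTo (ν μ l : ℕ) (f : ℕ × ℕ → ℕ∞) : ℕ∞ :=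
  ⨅ x ∈ {x : ℕ × ℕ | ∃ l₀ ≤ l, x ∈ pairsΩ ν μ l₀}, f x

end

/-!
Let `∑ a_h X ^ (h + n)` be the Teichmüller expansion of `π_K` in terms of `π_L`. The recursion that
defines the indices of inseparability has the closed form (`downRec_eq_gap`)

  `i_j = min_h (h + max (v_p (h + n) - j) 0 * v_L(p))`, the minimum over all `h` with `a_h ≠ 0`.

The indices are read off from the multiplicative shift of the expansion: the coefficient of `Y ^ r`
in `∑ a_h (π_L (1 + Y)) ^ (h + n)` is `∑ a_h C(h + n, r) π_L ^ (h + n)`. As `C(N, r)` is divisible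
by `p ^ (v_p(N) - v_p(r))`, exactly so for `r = p ^ j`, this coefficient has valuation at least
`n + i_j` with `j = v_p(r)` (`le_map_shiftCoeff`), with equality for `r = p ^ j` if `i_j < i_{j'}`
for all `j' < j` (`map_shiftCoeff_prime_pow`).

In a tower `M / L / K`, let `F`, `G`, `H` be the expansions of `π_K` in `π_L`, of `π_L` in `π_M`
and of `π_K` in `π_M`. The shift of `F ∘ G` is found by substituting
`G (π_M (1 + Y)) = π_L (1 + Z)`, `Z = ∑ z_t Y ^ t`, into the shift of `F`. By the multinomial
theorem each term of the coefficient of `Y ^ r` has valuation at least `n m + m i_j + p ^ j i'_k`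
for some `(j, k)` with `j + k ≤ v_p(r)` (`le_map_multiTerm`), and if the minimum of these numbers
is attained by a single pair `(j, k)`, then only one term of the coefficient of `Y ^ (p ^ (j + k))`
has that valuation (`map_coeff_composite_eq`).

The series `F ∘ G` does not have Teichmüller coefficients, so it differs from `H`; but both have
the value `π_K` at `π_M`, and their coefficients lie in the subring `B` generated by the Teichmüller
representatives, whose elements of positive valuation are multiples of `p` up to arbitrary precision
(`exists_approx_prime_mul`). In addition, `p` is itself the value of a power series in `π_K`
without constant term. Hence the coefficients of `Y, …, Y ^ (p ^ l)` in the shift of `F ∘ G - H` are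
divisible by one more power of `π_M` than what `i''_l` gives for those in the shift of `H`
(`le_coeff_mulShift_of_le_aeval`), and the indices of `M / K` can be read off from `F ∘ G` as well
(`le_gap_tower`, `gap_tower_le`). All this takes place in the valuation ring of `M`, with
polynomials that truncate the series at a high degree.

The independence of the uniformizers is the lower bound for the towers `L / K / K` and `L / L / K`
(`indexInsep_congr`). The uniqueness of the minimum on one level `j + k = l₀` gives a strict minimum
on all levels up to the lowest `l₀` with this property (`exists_strict_min_of_existsUnique`).
-/

open Polynomial

/-! ### Divisibility of binomial and multinomial coefficients -/

theorem prime_pow_dvd_choose {p : ℕ} [hp : Fact p.Prime] {N r : ℕ} (hr : r ≠ 0) :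
    p ^ (padicValNat p N - padicValNat p r) ∣ N.choose r := by
  rcases Nat.eq_zero_or_pos N with rfl | hN
  · simp
  by_cases h0 : N.choose r = 0
  · simp [h0]
  obtain ⟨N, rfl⟩ := Nat.exists_eq_succ_of_ne_zero hN.ne'
  obtain ⟨r, rfl⟩ := Nat.exists_eq_succ_of_ne_zero hr
  have h := Nat.add_one_mul_choose_eq N r
  have h1 : N.choose r ≠ 0 := by
    intro h1
    rw [h1, mul_zero] at h
    exact mul_ne_zero h0 hr h.symm
  have h2 := congrArg (padicValNat p) h
  rw [padicValNat.mul (Nat.succ_ne_zero _) h1, padicValNat.mul h0 hr] at h2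
  rw [padicValNat_dvd_iff_le h0]
  omega

/-- If `p ^ j ∣ N`, all entries `i < p ^ j` of the row `N - 1` of Pascal's triangle are prime
to `p`, because the entries `0 < i < p ^ j` of the row `N` are divisible by `p`. -/
theorem prime_not_dvd_choose_pred {p : ℕ} [hp : Fact p.Prime] {N j : ℕ} (hN : N ≠ 0)
    (hj : j ≤ padicValNat p N) (i : ℕ) (hi : i < p ^ j) : ¬ p ∣ (N - 1).choose i := by
  obtain ⟨N, rfl⟩ := Nat.exists_eq_succ_of_ne_zero hN
  induction i with
  | zero => simpa using hp.out.one_lt.ne'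
  | succ i ih =>
    have h1 : p ∣ (N + 1).choose (i + 1) := by
      have h2 : padicValNat p (i + 1) < j := by
        by_contra! h2
        have := Nat.le_of_dvd (Nat.succ_pos i)
          ((padicValNat_dvd_iff_le (p := p) (Nat.succ_ne_zero i)).2 h2)
        omega
      simp only [Nat.succ_eq_add_one] at hj
      exact (dvd_pow_self p (by omega)).trans (prime_pow_dvd_choose (Nat.succ_ne_zero i))
    rw [Nat.choose_succ_succ] at h1
    intro h2
    exact ih (by omega) ((Nat.dvd_add_left h2).1 h1)

/-- For `r = p ^ j` with `j ≤ v_p(N)`, the divisibility in `prime_pow_dvd_choose` is exact. -/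
theorem exists_choose_prime_pow_eq {p : ℕ} [hp : Fact p.Prime] {N j : ℕ} (hN : N ≠ 0)
    (hj : j ≤ padicValNat p N) :
    ∃ u, ¬ p ∣ u ∧ N.choose (p ^ j) = p ^ (padicValNat p N - j) * u := by
  have hpj : 0 < p ^ j := pow_pos hp.out.pos j
  obtain ⟨u, hu⟩ := prime_pow_dvd_choose (p := p) (N := N) hpj.ne'
  rw [padicValNat.prime_pow] at hu
  refine ⟨u, fun hpu => ?_, hu⟩
  have h1 := prime_not_dvd_choose_pred hN hj (p ^ j - 1) (by omega)
  have h := Nat.add_one_mul_choose_eq (N - 1) (p ^ j - 1)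
  rw [Nat.sub_add_cancel (by omega),
    Nat.sub_add_cancel (by omega)] at h
  have h0 : (N - 1).choose (p ^ j - 1) ≠ 0 := fun h0 => h1 (h0 ▸ dvd_zero p)
  have h3 : p ^ (padicValNat p N + 1) ∣ N * (N - 1).choose (p ^ j - 1) := by
    rw [h, hu]
    obtain ⟨w, rfl⟩ := hpu
    refine ⟨w, ?_⟩
    have : padicValNat p N + 1 = (padicValNat p N - j) + 1 + j := by omega
    rw [this]
    ring
  rw [padicValNat_dvd_iff_le (mul_ne_zero hN h0), padicValNat.mul hN h0,
    padicValNat.eq_zero_of_not_dvd h1] at h3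
  omega

theorem prime_pow_dvd_multinomial {p : ℕ} [hp : Fact p.Prime] {s : Finset ℕ} {k : ℕ → ℕ} {t : ℕ}
    (ht : t ∈ s) (hk : k t ≠ 0) :
    p ^ (padicValNat p (∑ i ∈ s, k i) - padicValNat p (k t)) ∣ Nat.multinomial s k := by
  rw [← Finset.insert_erase ht, Nat.multinomial_insert (Finset.notMem_erase t s),
    Finset.sum_insert (Finset.notMem_erase t s)]
  exact (prime_pow_dvd_choose hk).mul_right _

/-! ### The closed form of the indices of inseparability -/

/-- The minimum of `h + max (v_p (h + n) - j) 0 * e` over `h ∈ A`. For `A` the support of the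
coefficients of a Teichmüller expansion of a uniformizer of `K` in terms of a uniformizer of `L`,
`n = [L : K]` and `e = v_L(p)`, this is the index of inseparability `i_j`; the formula makes
sense for all `j`, and is `0` for `j ≥ v_p(n)`. -/
noncomputable def gap (p n : ℕ) (e : ℕ∞) (A : Set ℕ) (j : ℕ) : ℕ∞ :=
  ⨅ h ∈ A, (h : ℕ∞) + ((padicValNat p (h + n) - j : ℕ) : ℕ∞) * e

section gap

variable {p n : ℕ} {e : ℕ∞} {A : Set ℕ}

theorem gap_le {h : ℕ} (hh : h ∈ A) (j : ℕ) :
    gap p n e A j ≤ (h : ℕ∞) + ((padicValNat p (h + n) - j : ℕ) : ℕ∞) * e :=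
  iInf₂_le h hh

theorem gap_antitone : Antitone (gap p n e A) := by
  intro j j' hj
  refine le_iInf₂ fun h hh => (gap_le hh j').trans ?_
  gcongr

theorem gap_le_gap_add {j j' : ℕ} (hj : j ≤ j') :
    gap p n e A j ≤ gap p n e A j' + ((j' - j : ℕ) : ℕ∞) * e := by
  conv_rhs => rw [gap, ENat.iInf_add]
  refine le_iInf fun h => ?_
  rw [ENat.iInf_add]
  refine le_iInf fun hh => (gap_le hh j).trans ?_
  rw [add_assoc, ← add_mul]
  gcongr
  norm_cast
  omega

theorem gap_eq_zero (h0 : 0 ∈ A) {j : ℕ} (hj : padicValNat p n ≤ j) : gap p n e A j = 0 := by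
  have := gap_le (p := p) (n := n) (e := e) h0 j
  rw [zero_add, Nat.sub_eq_zero_of_le hj] at this
  simpa using this

/-- Indices beyond `v_p n` may be clipped to `v_p n`, so that pairs `(j, k)` outside of the range
`j ≤ ν`, `k ≤ μ` need no separate treatment. -/
theorem gap_min (h0 : 0 ∈ A) (j : ℕ) : gap p n e A (min j (padicValNat p n)) = gap p n e A j := by
  rcases le_total j (padicValNat p n) with hj | hj
  · rw [min_eq_left hj]
  · rw [min_eq_right hj, gap_eq_zero h0 le_rfl, gap_eq_zero h0 hj]

theorem exists_gap_eq (hA : A.Nonempty) (j : ℕ) :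
    ∃ h ∈ A, gap p n e A j = (h : ℕ∞) + ((padicValNat p (h + n) - j : ℕ) : ℕ∞) * e := by
  have := hA.to_subtype
  have h := ciInf_mem
    (fun h : A => ((h : ℕ) : ℕ∞) + ((padicValNat p (h + n) - j : ℕ) : ℕ∞) * e)
  rw [iInf_subtype] at h
  obtain ⟨⟨h, hh⟩, he⟩ := h
  exact ⟨h, hh, he.symm⟩

theorem gap_ne_zero (he : e ≠ 0) (hA : A.Nonempty) {j : ℕ} (hj : j < padicValNat p n) :
    gap p n e A j ≠ 0 := by
  obtain ⟨h, hh, heq⟩ := exists_gap_eq (p := p) (n := n) (e := e) hA j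
  rw [heq]
  intro h0
  rw [add_eq_zero, mul_eq_zero] at h0
  obtain ⟨h1, h2 | h2⟩ := h0
  · norm_cast at h1 h2
    subst h1
    rw [zero_add] at h2
    omega
  · exact he h2

/-- The recursive definition of the indices unfolds to `gap`; the terms with
`v_p (h + n) > v_p n`, which the recursion does not see, are at least as large as the term
`h = 0`. -/
theorem downRec_eq_gap (h0 : 0 ∈ A) (d : ℕ) (hd : d ≤ padicValNat p n) :
    downRec (padicValNat p n) (fun j => ⨅ h ∈ {h | padicValNat p (h + n) ≤ j ∧ h ∈ A}, (h : ℕ∞))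
      e d = gap p n e A (padicValNat p n - d) := by
  induction d with
  | zero =>
    rw [downRec, Nat.sub_zero, gap_eq_zero h0 le_rfl]
    refine le_antisymm (iInf₂_le_of_le 0 ⟨by simp, h0⟩ (by simp)) zero_le
  | succ d ih =>
    rw [downRec, ih (by omega)]
    set ν := padicValNat p n
    have e1 : ν - d = ν - (d + 1) + 1 := by omega
    rw [e1]
    set j := ν - (d + 1)
    apply le_antisymm
    · refine le_iInf₂ fun h hh => ?_
      rcases le_or_gt (padicValNat p (h + n)) j with hle | hlt
      · refine (min_le_left _ _).trans ((iInf₂_le h ⟨hle, hh⟩).trans ?_)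
        exact le_self_add
      · refine (min_le_right _ _).trans ?_
        have h2 : padicValNat p (h + n) - j = padicValNat p (h + n) - (j + 1) + 1 := by omega
        rw [h2, Nat.cast_add, add_mul, ← add_assoc, Nat.cast_one, one_mul]
        gcongr
        exact gap_le hh _
    · refine le_min (le_iInf₂ fun h hh => ?_) ?_
      · refine (gap_le hh.2 j).trans ?_
        rw [Nat.sub_eq_zero_of_le hh.1]
        simp
      · simpa using gap_le_gap_add (p := p) (n := n) (e := e) (A := A) (Nat.le_succ j)

/-- The minimum defining `gap` is attained only once: since `n ∣ e`, two places `h` where it is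
attained are congruent modulo `n`, so that `v_p (h + n)` is the same for both, unless it is at
least `v_p n`, which forces `h = 0`. -/
theorem gap_lt_of_ne [hp : Fact p.Prime] (hn : n ≠ 0) (hne : (n : ℕ∞) ∣ e) (h0 : 0 ∈ A) {j : ℕ}
    (hj : j ≤ padicValNat p n) (hfin : gap p n e A j ≠ ⊤) {h₀ h₁ : ℕ} (hh₁ : h₁ ∈ A)
    (heq : gap p n e A j = (h₀ : ℕ∞) + ((padicValNat p (h₀ + n) - j : ℕ) : ℕ∞) * e)
    (hne' : h₁ ≠ h₀) :
    gap p n e A j < (h₁ : ℕ∞) + ((padicValNat p (h₁ + n) - j : ℕ) : ℕ∞) * e := by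
  refine lt_of_le_of_ne (gap_le hh₁ j) fun heq₁ => hne' ?_
  have hle := gap_le (p := p) (n := n) (e := e) h0 j
  rw [zero_add] at hle
  induction e using ENat.recTopCoe with
  | top =>
    have key : ∀ h : ℕ, gap p n ⊤ A j = (h : ℕ∞) + ((padicValNat p (h + n) - j : ℕ) : ℕ∞) * ⊤ →
        gap p n ⊤ A j = h := by
      intro h hh
      by_cases h2 : padicValNat p (h + n) - j = 0
      · simpa [h2] using hh
      · exact absurd (hh.trans (by rw [ENat.mul_top (by exact_mod_cast h2), add_top])) hfin
    have := (key _ heq₁).symm.trans (key _ heq)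
    exact_mod_cast this
  | coe e =>
    obtain ⟨e', he'⟩ : n ∣ e := by
      obtain ⟨c, hc⟩ := hne
      induction c using ENat.recTopCoe with
      | top =>
        rw [ENat.mul_top (by exact_mod_cast hn)] at hc
        exact absurd hc (ENat.natCast_ne_top e)
      | coe c => exact ⟨c, by exact_mod_cast hc⟩
    rw [heq] at hle heq₁
    norm_cast at hle heq₁
    rw [zero_add] at hle
    have hdvd : p ^ padicValNat p n ∣ n := pow_padicValNat_dvd
    have hcongr : ∀ i, p ^ i ∣ n → (p ^ i ∣ h₀ + n ↔ p ^ i ∣ h₁ + n) := by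
      intro i hi
      have hie : p ^ i ∣ e := hi.trans ⟨e', he'⟩
      rw [Nat.dvd_add_left hi, Nat.dvd_add_left hi,
        ← Nat.dvd_add_left (hie.mul_left (padicValNat p (h₀ + n) - j)), heq₁,
        Nat.dvd_add_left (hie.mul_left _)]
    have hcongr' : ∀ i ≤ padicValNat p n,
        (i ≤ padicValNat p (h₀ + n) ↔ i ≤ padicValNat p (h₁ + n)) := by
      intro i hi
      rw [← padicValNat_dvd_iff_le (by omega), ← padicValNat_dvd_iff_le (by omega)]
      exact hcongr i ((pow_dvd_pow p hi).trans hdvd)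
    set ν := padicValNat p n
    set t₀ := padicValNat p (h₀ + n)
    set t₁ := padicValNat p (h₁ + n)
    rcases lt_or_ge t₀ ν with h2 | h2
    · have h3 : t₀ = t₁ := by
        have := hcongr' t₀ h2.le
        have := hcongr' (t₀ + 1) h2
        omega
      rw [h3] at heq₁
      omega
    · have h3 : ν ≤ t₁ := (hcongr' ν le_rfl).1 h2
      have h4 : (ν - j) * e ≤ (t₀ - j) * e := Nat.mul_le_mul_right _ (by omega)
      have h5 : (ν - j) * e ≤ (t₁ - j) * e := Nat.mul_le_mul_right _ (by omega)
      omega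

end gap

/-! ### Multiplicative shifts of expansions -/

section AddValuation

variable {S : Type*} [CommRing S] (v : AddValuation S ℕ∞)

theorem AddValuation.natCast_eq_zero_of_not_dvd {p : ℕ} (hp : p.Prime) (hvp : v (p : S) ≠ 0)
    {u : ℕ} (hu : ¬ p ∣ u) : v (u : S) = 0 := by
  by_contra h
  have hc : Int.gcd u p = 1 := by
    rw [Int.gcd_natCast_natCast]
    exact Nat.Coprime.symm ((Nat.Prime.coprime_iff_not_dvd hp).2 hu)
  have hb := Int.gcd_eq_gcd_ab u p
  rw [hc] at hb
  have hb' := congrArg (Int.cast : ℤ → S) hb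
  push_cast at hb'
  have h1 : (1 : ℕ∞) ≤ v (1 : S) := by
    conv_rhs => rw [← Nat.cast_one (R := S)]
    simp only [Nat.cast_one]
    rw [hb']
    refine v.map_le_add ?_ ?_ <;> rw [v.map_mul]
    · exact (Order.one_le_iff_ne_zero.2 h).trans le_self_add
    · exact (Order.one_le_iff_ne_zero.2 hvp).trans le_self_add
  rw [v.map_one] at h1
  simp at h1

theorem AddValuation.map_sum_eq_of_lt {ι : Type*} {s : Finset ι} {f : ι → S} {i : ι} (hi : i ∈ s)
    (hfin : v (f i) ≠ ⊤) (h : ∀ i' ∈ s, i' ≠ i → v (f i) < v (f i')) :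
    v (∑ i ∈ s, f i) = v (f i) := by
  classical
  rw [← Finset.add_sum_erase s f hi]
  apply v.map_add_eq_of_lt_left
  apply v.map_lt_sum hfin
  intro i' hi'
  exact h i' (Finset.mem_of_mem_erase hi') (Finset.ne_of_mem_erase hi')

/-- The coefficient of `Y ^ r` in `∑_{h < N} a_h (π (1 + Y)) ^ (h + n)`. -/
def shiftCoeff (a : ℕ → S) (n N : ℕ) (π : S) (r : ℕ) : S :=
  ∑ h ∈ Finset.range N, a h * ((h + n).choose r : S) * π ^ (h + n)

variable {v} {p n d : ℕ} {e : ℕ∞} {a : ℕ → S} {π : S}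

theorem le_map_choose [hp : Fact p.Prime] (hvp : v (p : S) = d * e) (N : ℕ) {r : ℕ} (hr : r ≠ 0) :
    d * (((padicValNat p N - padicValNat p r : ℕ) : ℕ∞) * e) ≤ v (N.choose r : S) := by
  obtain ⟨u, hu⟩ := prime_pow_dvd_choose (p := p) (N := N) hr
  rw [hu, Nat.cast_mul, Nat.cast_pow, v.map_mul, v.map_pow, hvp, nsmul_eq_mul]
  refine le_trans (le_of_eq ?_) le_self_add
  ring

/-- The coefficient of `Y ^ r` is bounded from below by the index `i_j` with `j = v_p(r)`. -/
theorem le_map_shiftCoeff [hp : Fact p.Prime] (hvp : v (p : S) = d * e) (hπ : v π = d) (N : ℕ)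
    {r : ℕ} (hr : r ≠ 0) :
    d * (n + gap p n e {h | a h ≠ 0} (padicValNat p r)) ≤ v (shiftCoeff a n N π r) := by
  refine v.map_le_sum fun h _ => ?_
  by_cases ha : a h = 0
  · simp [ha]
  rw [v.map_mul, v.map_mul, v.map_pow, hπ, nsmul_eq_mul]
  refine le_trans ?_ (add_le_add_left (le_add_left (le_map_choose hvp (h + n) hr)) _)
  calc (d : ℕ∞) * (n + gap p n e {h | a h ≠ 0} (padicValNat p r))
      ≤ d * (n + (h + ((padicValNat p (h + n) - padicValNat p r : ℕ) : ℕ∞) * e)) := by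
        gcongr
        exact gap_le ha _
    _ = _ := by push_cast; ring

/-- If the index `i_j` is smaller than all `i_{j'}` with `j' < j`, it is the valuation of the
single coefficient of `Y ^ (p ^ j)`. -/
theorem map_shiftCoeff_prime_pow [hp : Fact p.Prime] (hvp : v (p : S) = d * e)
    (hvp0 : v (p : S) ≠ 0) (hd : d ≠ 0) (hπ : v π = d) (hn : n ≠ 0) (hne : (n : ℕ∞) ∣ e)
    (ha : ∀ h, a h = 0 ∨ v (a h) = 0) (ha0 : a 0 ≠ 0) {j : ℕ} (hj : j ≤ padicValNat p n)
    (hlt : ∀ j' < j, gap p n e {h | a h ≠ 0} j < gap p n e {h | a h ≠ 0} j') {N : ℕ}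
    (hN : gap p n e {h | a h ≠ 0} j < N) :
    v (shiftCoeff a n N π (p ^ j)) = d * (n + gap p n e {h | a h ≠ 0} j) := by
  set A := {h | a h ≠ 0}
  have hfin : gap p n e A j ≠ ⊤ := ne_top_of_lt hN
  obtain ⟨h₀, hh₀, heq⟩ := exists_gap_eq (p := p) (n := n) (e := e) (A := A) ⟨0, ha0⟩ j
  have hpj : p ^ j ≠ 0 := (pow_pos hp.out.pos j).ne'
  have ht₀ : j ≤ padicValNat p (h₀ + n) := by
    by_contra! ht
    have h1 := (hlt _ ht).trans_le (gap_le hh₀ _)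
    rw [heq, Nat.sub_eq_zero_of_le ht.le, Nat.sub_self] at h1
    exact lt_irrefl _ h1
  have hh₀N : h₀ ∈ Finset.range N := by
    rw [Finset.mem_range]
    have : (h₀ : ℕ∞) ≤ gap p n e A j := by rw [heq]; exact le_self_add
    exact_mod_cast this.trans_lt hN
  have hval : v (a h₀ * ((h₀ + n).choose (p ^ j) : S) * π ^ (h₀ + n)) =
      d * (n + gap p n e A j) := by
    obtain ⟨u, hu, hc⟩ := exists_choose_prime_pow_eq (p := p) (N := h₀ + n) (by omega) ht₀
    rw [v.map_mul, v.map_mul, v.map_pow, hπ, nsmul_eq_mul, (ha h₀).resolve_left hh₀, hc,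
      Nat.cast_mul, Nat.cast_pow, v.map_mul, v.map_pow, hvp,
      v.natCast_eq_zero_of_not_dvd hp.out hvp0 hu, heq, nsmul_eq_mul]
    push_cast
    ring
  rw [← hval]
  refine v.map_sum_eq_of_lt hh₀N ?_ fun h₁ _ hne₁ => ?_
  · rw [hval]
    exact WithTop.mul_ne_top (ENat.natCast_ne_top d)
      (WithTop.add_ne_top.2 ⟨ENat.natCast_ne_top n, hfin⟩)
  rw [hval]
  have hlt' : ∀ x : ℕ∞, gap p n e A j < x → d * (n + gap p n e A j) < d * (n + x) := by
    intro x hx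
    have hd' : (d : ℕ∞) ≠ 0 := by exact_mod_cast hd
    have h1 : (n : ℕ∞) + gap p n e A j < n + x :=
      (ENat.add_lt_add_iff_left (ENat.natCast_ne_top n)).2 hx
    exact lt_of_not_ge fun h2 =>
      h1.not_ge ((ENat.mul_le_mul_left_iff hd' (ENat.natCast_ne_top d)).1 h2)
  by_cases ha₁ : a h₁ = 0
  · rw [ha₁, zero_mul, zero_mul, v.map_zero]
    exact (hlt' ⊤ (lt_top_iff_ne_top.2 hfin)).trans_le le_top
  refine (hlt' _ (gap_lt_of_ne hn hne ha0 hj hfin ha₁ heq hne₁)).trans_le ?_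
  rw [v.map_mul, v.map_mul, v.map_pow, hπ, nsmul_eq_mul]
  have h2 := le_map_choose (v := v) hvp (h₁ + n) hpj
  rw [padicValNat.prime_pow] at h2
  refine le_trans (le_of_eq ?_) (add_le_add_left (le_add_left h2) _)
  push_cast
  ring

end AddValuation

/-! ### Independence of the representing polynomial -/

section shift

variable {S : Type*} [CommRing S] {v : AddValuation S ℕ∞} {B : Subring S}

theorem AddValuation.le_map_sub {x y : S} {c : ℕ∞} (hx : c ≤ v x) (hy : c ≤ v y) :
    c ≤ v (x - y) := by
  rw [sub_eq_add_neg]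
  exact v.map_le_add hx (by rwa [v.map_neg])

/-- The polynomial `D (π (1 + Y))`. -/
noncomputable def mulShift (π : S) (D : B[X]) : S[X] := aeval (C π * (1 + X)) D

theorem coeff_zero_mulShift (π : S) (D : B[X]) : (mulShift π D).coeff 0 = aeval π D := by
  rw [mulShift, coeff_zero_eq_aeval_zero]
  have h2 := (aeval_algHom_apply ((aeval (R := S) (0 : S)).restrictScalars B)
    (C π * (1 + X) : S[X]) D)
  simpa using h2.symm

theorem le_coeff_mul {q : ℕ} {c : ℕ∞} {f g : S[X]} (hf : ∀ r ≤ q, c ≤ v (f.coeff r)) :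
    ∀ r ≤ q, c ≤ v ((f * g).coeff r) := by
  intro r hr
  rw [coeff_mul]
  refine v.map_le_sum fun x hx => ?_
  rw [v.map_mul]
  have := Finset.HasAntidiagonal.mem_antidiagonal.1 hx
  exact (hf x.1 (by omega)).trans le_self_add

theorem le_coeff_aeval_sub {q : ℕ} {c : ℕ∞} {f g : S[X]}
    (hfg : ∀ r ≤ q, c ≤ v ((f - g).coeff r)) (Q : B[X]) :
    ∀ r ≤ q, c ≤ v ((aeval f Q - aeval g Q).coeff r) := by
  obtain ⟨w, hw⟩ := sub_dvd_eval_sub f g (Q.map (algebraMap B S[X]))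
  rw [eval_map_algebraMap, eval_map_algebraMap] at hw
  rw [hw]
  exact le_coeff_mul hfg

theorem le_map_aeval_sub {c : ℕ∞} {x y : S} (hxy : c ≤ v (x - y)) (Q : B[X]) :
    c ≤ v (aeval x Q - aeval y Q) := by
  obtain ⟨w, hw⟩ := sub_dvd_eval_sub x y (Q.map (algebraMap B S))
  rw [eval_map_algebraMap, eval_map_algebraMap] at hw
  rw [hw, v.map_mul]
  exact hxy.trans le_self_add

theorem mulShift_C (π : S) (w : B) : mulShift π (C w) = C (w : S) := by
  simp [mulShift]
  rfl

theorem coeff_mulShift_X_mul (π : S) (D : B[X]) (r : ℕ) :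
    (mulShift π (X * D)).coeff (r + 1) =
      π * ((mulShift π D).coeff (r + 1) + (mulShift π D).coeff r) := by
  rw [mulShift, map_mul, aeval_X, ← mulShift, mul_assoc, coeff_C_mul, add_mul, one_mul, coeff_add,
    coeff_X_mul]

/-- Suppose that all elements of positive valuation in `B` are approximately multiples of `p`, and
that `p` is approximated by values `P (π)` of polynomials over `B` such that the coefficients of
`Y, …, Y ^ q` in `P (π (1 + Y))` have valuation at least `c`. If `D (π)` is close to `0`, then the
coefficients of `Y, …, Y ^ q` in `D (π (1 + Y))` have valuation at least `c`, and even `c + 1` if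
`D` has no constant term.

The constant term of `D` is approximately `p * w`; replacing it by `w * P (π)` gives a polynomial
divisible by `X`, and the claim follows by induction on the precision. -/
theorem le_coeff_mulShift_of_le_aeval {p : ℕ} {π : S} (hπ : v π = 1)
    (hB : ∀ w ∈ B, 0 < v w → ∀ N : ℕ, ∃ w' ∈ B, (N : ℕ∞) ≤ v (w - p * w')) {q : ℕ} {c : ℕ∞}
    (hP : ∀ N : ℕ, ∃ P : B[X], P.coeff 0 = 0 ∧ (N : ℕ∞) ≤ v (p - aeval π P) ∧
      ∀ r < q, c ≤ v ((mulShift π P).coeff (r + 1))) (N : ℕ) (D : B[X])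
    (hD : (N : ℕ∞) ≤ v (aeval π D)) :
    (∀ r < q, min c N ≤ v ((mulShift π D).coeff (r + 1))) ∧
      (D.coeff 0 = 0 → ∀ r < q, min (c + 1) N ≤ v ((mulShift π D).coeff (r + 1))) := by
  induction N generalizing D with
  | zero => simp
  | succ N ih =>
    obtain ⟨P, hP0, hPp, hPc⟩ := hP (N + 1)
    have hDX : D = X * D.divX + C (D.coeff 0) := (X_mul_divX_add D).symm
    have hPX : P = X * P.divX := by
      conv_lhs => rw [← X_mul_divX_add P, hP0, C_0, add_zero]
    have hD0 : aeval π D = π * aeval π D.divX + (D.coeff 0 : S) := by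
      have h1 := congrArg (aeval π) hDX
      rwa [map_add, map_mul, aeval_X, aeval_C] at h1
    have hP1 : aeval π P = π * aeval π P.divX := by
      have h1 := congrArg (aeval π) hPX
      rwa [map_mul, aeval_X] at h1
    have hpos : 0 < v (D.coeff 0 : S) := by
      rw [← Order.one_le_iff_pos]
      have h1 : (D.coeff 0 : S) = aeval π D - π * aeval π D.divX := by rw [hD0]; ring
      rw [h1]
      refine AddValuation.le_map_sub (le_trans (by simp) hD) ?_
      rw [v.map_mul, hπ]
      exact le_self_add
    obtain ⟨w, hw, hw0⟩ : ∃ w : B, ((N + 1 : ℕ) : ℕ∞) ≤ v ((D.coeff 0 : S) - p * w) ∧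
        (D.coeff 0 = 0 → w = 0) := by
      by_cases h0 : D.coeff 0 = 0
      · exact ⟨0, by simp [h0], fun _ => rfl⟩
      · obtain ⟨w, hwB, hw⟩ := hB _ (D.coeff 0).2 hpos (N + 1)
        exact ⟨⟨w, hwB⟩, hw, fun h => absurd h h0⟩
    set D₂ : B[X] := C w * P.divX + D.divX
    have hD₂ : (N : ℕ∞) ≤ v (aeval π D₂) := by
      have h1 : π * aeval π D₂ = aeval π D - ((D.coeff 0 : S) - p * w) - w * (p - aeval π P) := by
        have : aeval π D₂ = w * aeval π P.divX + aeval π D.divX := by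
          simp [D₂]
          rfl
        rw [this, hD0, hP1]
        ring
      have h2 : ((N + 1 : ℕ) : ℕ∞) ≤ v (π * aeval π D₂) := by
        rw [h1]
        refine AddValuation.le_map_sub (AddValuation.le_map_sub hD hw) ?_
        rw [v.map_mul]
        exact hPp.trans le_add_self
      rw [v.map_mul, hπ, Nat.cast_add, Nat.cast_one, add_comm] at h2
      exact (ENat.add_le_add_iff_left ENat.one_ne_top).1 h2
    have hmain : ∀ r < q, min (c + 1) ((N + 1 : ℕ) : ℕ∞) ≤
        v ((mulShift π (X * D₂)).coeff (r + 1)) := by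
      intro r hr
      rw [coeff_mulShift_X_mul, v.map_mul, hπ, add_comm 1, Nat.cast_add, Nat.cast_one,
        min_add_add_right]
      gcongr
      refine v.map_le_add ((ih D₂ hD₂).1 r hr) ?_
      cases r with
      | zero =>
        rw [coeff_zero_mulShift]
        exact (min_le_right _ _).trans hD₂
      | succ r => exact (ih D₂ hD₂).1 r (by omega)
    have hsum : ∀ r, (mulShift π D).coeff (r + 1) =
        (mulShift π (X * D₂)).coeff (r + 1) - w * (mulShift π P).coeff (r + 1) := by
      intro r
      have h1 : D = X * D₂ - C w * P + C (D.coeff 0) := by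
        conv_lhs => rw [hDX]
        conv_rhs => rw [hPX]
        simp only [D₂]
        ring
      have h2 : mulShift π D = mulShift π (X * D₂) - C (w : S) * mulShift π P +
          C (D.coeff 0 : S) := by
        conv_lhs => rw [h1]
        rw [← mulShift_C π w, ← mulShift_C π (D.coeff 0)]
        simp only [mulShift, map_add, map_sub, map_mul]
      rw [h2]
      simp
    refine ⟨fun r hr => ?_, fun h0 r hr => ?_⟩
    · rw [hsum]
      refine AddValuation.le_map_sub
        ((min_le_min le_self_add le_rfl).trans (hmain r hr)) ?_
      rw [v.map_mul]
      exact (min_le_left _ _).trans ((hPc r hr).trans le_add_self)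
    · rw [hsum, hw0 h0]
      simpa using hmain r hr

/-! ### Coefficients of a composite of two expansions -/

/-- The polynomial `∑_{h < N} a_h X ^ (h + n)`. -/
noncomputable def truncPoly (a : ℕ → B) (n N : ℕ) : B[X] :=
  ∑ h ∈ Finset.range N, C (a h) * X ^ (h + n)

theorem aeval_truncPoly {A : Type*} [CommRing A] [Algebra B A] (a : ℕ → B) (n N : ℕ) (x : A) :
    aeval x (truncPoly a n N) = ∑ h ∈ Finset.range N, algebraMap B A (a h) * x ^ (h + n) := by
  simp [truncPoly]

theorem coeff_zero_truncPoly (a : ℕ → B) {n : ℕ} (hn : n ≠ 0) (N : ℕ) :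
    (truncPoly a n N).coeff 0 = 0 := by
  rw [truncPoly, finsetSum_coeff]
  refine Finset.sum_eq_zero fun h _ => ?_
  rw [coeff_C_mul, coeff_X_pow, if_neg (by omega), mul_zero]

theorem aeval_truncPoly_mul_one_add (a : ℕ → B) (n N : ℕ) (x : S) (Z : S[X]) :
    aeval (C x * (1 + Z)) (truncPoly a n N) =
      ∑ s ∈ Finset.range (N + n), C (shiftCoeff (fun h => (a h : S)) n N x s) * Z ^ s := by
  simp only [aeval_truncPoly, shiftCoeff, map_sum, Finset.sum_mul]
  rw [Finset.sum_comm]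
  refine Finset.sum_congr rfl fun h hh => ?_
  have hh' := Finset.mem_range.1 hh
  have h1 : (1 + Z) ^ (h + n) =
      ∑ s ∈ Finset.range (N + n), ((h + n).choose s : S[X]) * Z ^ s := by
    rw [add_comm 1 Z, add_pow]
    refine (Finset.sum_subset (Finset.range_mono (by omega : h + n + 1 ≤ N + n))
      fun s _ hs => ?_).trans ?_
    · rw [Finset.mem_range, not_lt] at hs
      rw [Nat.choose_eq_zero_of_lt (by omega)]
      simp
    · refine Finset.sum_congr rfl fun s _ => ?_
      rw [one_pow, mul_one, mul_comm]
  have h2 : algebraMap B S[X] (a h) = C (a h : S) := rfl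
  rw [mul_pow, h1, h2, Finset.mul_sum, Finset.mul_sum]
  refine Finset.sum_congr rfl fun s _ => ?_
  simp only [map_mul, map_pow, map_natCast]
  ring

theorem coeff_mulShift_truncPoly (a : ℕ → B) (n N : ℕ) (x : S) (r : ℕ) :
    (mulShift x (truncPoly a n N)).coeff r = shiftCoeff (fun h => (a h : S)) n N x r := by
  rw [mulShift, aeval_truncPoly_mul_one_add, finsetSum_coeff]
  simp only [coeff_C_mul, coeff_X_pow]
  rw [Finset.sum_eq_single r]
  · simp
  · intro s _ hs
    rw [if_neg hs.symm, mul_zero]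
  · intro h
    rw [Finset.mem_range, not_lt] at h
    rw [if_pos rfl, mul_one, shiftCoeff]
    refine Finset.sum_eq_zero fun i hi => ?_
    rw [Finset.mem_range] at hi
    rw [Nat.choose_eq_zero_of_lt (by omega)]
    simp

end shift

/-- The contribution of `f_s Z ^ s`, `Z = ∑ z_t Y ^ t`, that belongs to the exponents `k_t`. -/
noncomputable def multiTerm {S : Type*} [CommRing S] (f z : ℕ → S) (I : Finset ℕ) (s : ℕ)
    (k : ℕ → ℕ) : S :=
  f s * (Nat.multinomial I k * ∏ t ∈ I, z t ^ k t)

/-- The coefficient of `Y ^ r` in `∑ f_s Z ^ s`, `Z = ∑ z_t Y ^ t`, by the multinomial theorem. -/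
theorem coeff_sum_mul_pow {S : Type*} [CommRing S] (f z : ℕ → S) (I : Finset ℕ) (R r : ℕ) :
    (∑ s ∈ Finset.range R, C (f s) * (∑ t ∈ I, C (z t) * X ^ t) ^ s).coeff r =
      ∑ x ∈ ((Finset.range R).sigma fun s => I.piAntidiag s) with ∑ t ∈ I, t * x.2 t = r,
        multiTerm f z I x.1 x.2 := by
  rw [Finset.sum_filter, Finset.sum_sigma, finsetSum_coeff]
  refine Finset.sum_congr rfl fun s _ => ?_
  rw [Finset.sum_pow_eq_sum_piAntidiag, coeff_C_mul, finsetSum_coeff, Finset.mul_sum]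
  refine Finset.sum_congr rfl fun k _ => ?_
  have h1 : ((Nat.multinomial I k : S[X]) * ∏ t ∈ I, (C (z t) * X ^ t) ^ k t) =
      C ((Nat.multinomial I k : S) * ∏ t ∈ I, z t ^ k t) * X ^ (∑ t ∈ I, t * k t) := by
    simp only [mul_pow, Finset.prod_mul_distrib, ← pow_mul, Finset.prod_pow_eq_pow_sum, map_mul,
      map_prod, map_pow, map_natCast]
    ring
  rw [h1, coeff_C_mul, coeff_X_pow, multiTerm]
  split_ifs with h2 h3 h3
  · rw [mul_one]
  · exact absurd h2.symm h3
  · exact absurd h3.symm h2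
  · rw [mul_zero, mul_zero]

/-! ### Valuations of the coefficients of the composite -/

/-- With `c` the least `p`-adic valuation of an exponent `k_t ≠ 0`, some `t` with `k_t ≠ 0`
satisfies `v_p(t) + c ≤ v_p(∑ t k_t)`. -/
theorem exists_le_padicValNat_sum_mul {p : ℕ} [hp : Fact p.Prime] {I : Finset ℕ} {k : ℕ → ℕ}
    (hr : ∑ t ∈ I, t * k t ≠ 0) :
    ∃ t₀ ∈ I, k t₀ ≠ 0 ∧ (∀ t ∈ I, p ^ padicValNat p (k t₀) ∣ k t) ∧
      ∃ t₁ ∈ I, k t₁ ≠ 0 ∧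
        padicValNat p (k t₀) + padicValNat p t₁ ≤ padicValNat p (∑ t ∈ I, t * k t) := by
  have hne : (I.filter fun t => k t ≠ 0).Nonempty := by
    by_contra h
    rw [Finset.not_nonempty_iff_eq_empty, Finset.filter_eq_empty_iff] at h
    refine hr (Finset.sum_eq_zero fun t ht => ?_)
    rw [not_ne_iff.1 (h ht), mul_zero]
  obtain ⟨t₀, ht₀, hmin⟩ := Finset.exists_min_image _ (fun t => padicValNat p (k t)) hne
  rw [Finset.mem_filter] at ht₀
  have hdvd : ∀ t ∈ I, p ^ padicValNat p (k t₀) ∣ k t := by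
    intro t ht
    by_cases h0 : k t = 0
    · simp [h0]
    · rw [padicValNat_dvd_iff_le h0]
      exact hmin t (Finset.mem_filter.2 ⟨ht, h0⟩)
  refine ⟨t₀, ht₀.1, ht₀.2, hdvd, ?_⟩
  by_contra! h
  have h1 : p ^ (padicValNat p (∑ t ∈ I, t * k t) + 1) ∣ ∑ t ∈ I, t * k t := by
    refine Finset.dvd_sum fun t ht => ?_
    by_cases h0 : k t = 0
    · simp [h0]
    · refine (pow_dvd_pow p (h t ht h0)).trans ?_
      rw [pow_add, mul_comm]
      exact mul_dvd_mul pow_padicValNat_dvd (hdvd t ht)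
  rw [padicValNat_dvd_iff_le hr] at h1
  omega

section composite

variable {S : Type*} [CommRing S] {v : AddValuation S ℕ∞} {p n d : ℕ} [hp : Fact p.Prime] {e : ℕ∞}
  {a : ℕ → S} {x : S} {N : ℕ} {z : ℕ → S} {I : Finset ℕ} {i' : ℕ → ℕ∞}

/-- A term of the multinomial expansion of the composite is bounded from below by the value
`d i_c + p ^ c i'_k` of a pair `(c, k)` with `c + k ≤ v_p(r)`: `c` is the least `p`-adic valuation
of a nonzero exponent, and the multinomial coefficient makes up for the difference between `i_c`
and `i_{v_p(s)}`, `s` being the sum of the exponents. -/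
theorem le_map_multiTerm (hvp : v (p : S) = d * e) (hx : v x = d)
    (hz : ∀ t ∈ I, i' (padicValNat p t) ≤ v (z t)) {k : ℕ → ℕ}
    (hr : ∑ t ∈ I, t * k t ≠ 0) :
    ∃ c, ∃ t ∈ I, k t ≠ 0 ∧ p ^ c ∣ k t ∧
      c + padicValNat p t ≤ padicValNat p (∑ t ∈ I, t * k t) ∧
      d * n + (d * gap p n e {h | a h ≠ 0} c + (p : ℕ∞) ^ c * i' (padicValNat p t)) ≤
        v (multiTerm (shiftCoeff a n N x) z I (∑ t ∈ I, k t) k) := by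
  obtain ⟨t₀, ht₀, hk₀, hdvd, t₁, ht₁, hk₁, hle⟩ := exists_le_padicValNat_sum_mul (p := p) hr
  refine ⟨padicValNat p (k t₀), t₁, ht₁, hk₁, hdvd t₁ ht₁, hle, ?_⟩
  set c := padicValNat p (k t₀)
  have hs : ∑ t ∈ I, k t ≠ 0 := fun h => hk₀ (Finset.sum_eq_zero_iff.1 h t₀ ht₀)
  have hcs : c ≤ padicValNat p (∑ t ∈ I, k t) := by
    rw [← padicValNat_dvd_iff_le hs]
    exact Finset.dvd_sum hdvd
  have hf := le_map_shiftCoeff (a := a) (n := n) hvp hx N hs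
  set s := ∑ t ∈ I, k t
  have hmul : d * (((padicValNat p s - c : ℕ) : ℕ∞) * e) ≤ v (Nat.multinomial I k : S) := by
    obtain ⟨u, hu⟩ := prime_pow_dvd_multinomial (p := p) ht₀ hk₀
    rw [hu, Nat.cast_mul, Nat.cast_pow, v.map_mul, v.map_pow, hvp, nsmul_eq_mul]
    refine le_trans (le_of_eq ?_) le_self_add
    ring
  have hprod : (p : ℕ∞) ^ c * i' (padicValNat p t₁) ≤ v (∏ t ∈ I, z t ^ k t) := by
    classical
    rw [← Finset.mul_prod_erase I _ ht₁, v.map_mul, v.map_pow, nsmul_eq_mul]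
    refine le_trans ?_ le_self_add
    refine mul_le_mul' ?_ (hz t₁ ht₁)
    exact_mod_cast Nat.le_of_dvd (Nat.pos_of_ne_zero hk₁) (hdvd t₁ ht₁)
  rw [multiTerm, v.map_mul, v.map_mul]
  calc _ = (d * (n + gap p n e {h | a h ≠ 0} c)) +
        (p : ℕ∞) ^ c * i' (padicValNat p t₁) := by ring
    _ ≤ d * (n + (gap p n e {h | a h ≠ 0} (padicValNat p s) +
        ((padicValNat p s - c : ℕ) : ℕ∞) * e)) + (p : ℕ∞) ^ c * i' (padicValNat p t₁) := by
        gcongr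
        exact gap_le_gap_add hcs
    _ = d * (n + gap p n e {h | a h ≠ 0} (padicValNat p s)) +
        (d * (((padicValNat p s - c : ℕ) : ℕ∞) * e) +
          (p : ℕ∞) ^ c * i' (padicValNat p t₁)) := by ring
    _ ≤ _ := by gcongr

theorem le_map_coeff_composite (hvp : v (p : S) = d * e) (hx : v x = d)
    (hz : ∀ t ∈ I, i' (padicValNat p t) ≤ v (z t)) {l : ℕ} {b : ℕ∞}
    (hb : ∀ c k, c + k ≤ l → b ≤ d * gap p n e {h | a h ≠ 0} c + (p : ℕ∞) ^ c * i' k)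
    {r : ℕ} (hr : r ≠ 0) (hrl : padicValNat p r ≤ l) (R : ℕ) :
    d * n + b ≤ v ((∑ s ∈ Finset.range R,
      C (shiftCoeff a n N x s) * (∑ t ∈ I, C (z t) * X ^ t) ^ s).coeff r) := by
  rw [coeff_sum_mul_pow]
  refine v.map_le_sum fun y hy => ?_
  obtain ⟨hy', rfl⟩ := Finset.mem_filter.1 hy
  have hys : ∑ t ∈ I, y.2 t = y.1 := (Finset.mem_piAntidiag.1 (Finset.mem_sigma.1 hy').2).1
  obtain ⟨c, t, _, _, _, hct, hle⟩ := le_map_multiTerm (a := a) (n := n) (N := N) hvp hx hz hr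
  rw [hys] at hle
  refine le_trans ?_ hle
  gcongr
  exact hb _ _ (hct.trans hrl)

/-- If `(j, k)` is the only minimum of `d i_c + p ^ c i'_{k'}` on `c + k' ≤ j + k`, the coefficient
of `Y ^ (p ^ (j + k))` has only one term of minimal valuation, namely
`f_{p ^ j} (z_{p ^ k}) ^ (p ^ j)`. -/
theorem map_coeff_composite_eq (hvp : v (p : S) = d * e) (hx : v x = d)
    (hz : ∀ t ∈ I, i' (padicValNat p t) ≤ v (z t)) (hI : 0 ∉ I) {j k : ℕ}
    (hlt : ∀ c k', c + k' ≤ j + k → (c, k') ≠ (j, k) →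
      d * gap p n e {h | a h ≠ 0} j + (p : ℕ∞) ^ j * i' k <
        d * gap p n e {h | a h ≠ 0} c + (p : ℕ∞) ^ c * i' k')
    (hfin : d * gap p n e {h | a h ≠ 0} j + (p : ℕ∞) ^ j * i' k ≠ ⊤)
    (hkI : p ^ k ∈ I) {R : ℕ} (hjR : p ^ j < R)
    (hfj : v (shiftCoeff a n N x (p ^ j)) = d * (n + gap p n e {h | a h ≠ 0} j))
    (hzk : v (z (p ^ k)) = i' k) :
    v ((∑ s ∈ Finset.range R,
      C (shiftCoeff a n N x s) * (∑ t ∈ I, C (z t) * X ^ t) ^ s).coeff (p ^ (j + k))) =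
        d * n + (d * gap p n e {h | a h ≠ 0} j + (p : ℕ∞) ^ j * i' k) := by
  classical
  have hpos : ∀ i, 0 < p ^ i := fun i => pow_pos hp.out.pos i
  rw [coeff_sum_mul_pow]
  set y₀ : (_ : ℕ) × (ℕ → ℕ) := ⟨p ^ j, Pi.single (p ^ k) (p ^ j)⟩
  have hval : v (multiTerm (shiftCoeff a n N x) z I y₀.1 y₀.2) =
      d * n + (d * gap p n e {h | a h ≠ 0} j + (p : ℕ∞) ^ j * i' k) := by
    have h1 : ∏ t ∈ I, z t ^ (Pi.single (p ^ k) (p ^ j) : ℕ → ℕ) t = z (p ^ k) ^ p ^ j := by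
      rw [Finset.prod_eq_single (p ^ k)]
      · simp
      · intro t _ ht
        simp [Pi.single_eq_of_ne ht]
      · exact fun h => absurd hkI h
    have h2 : Nat.multinomial I (Pi.single (p ^ k) (p ^ j) : ℕ → ℕ) = 1 := by
      rw [← Finset.insert_erase hkI, Nat.multinomial_insert (Finset.notMem_erase _ _)]
      have h3 : ∀ t ∈ I.erase (p ^ k), (Pi.single (p ^ k) (p ^ j) : ℕ → ℕ) t = 0 :=
        fun t ht => Pi.single_eq_of_ne (Finset.ne_of_mem_erase ht) _
      rw [Finset.sum_eq_zero h3, Nat.multinomial_congr (g := 0) h3]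
      simp [Nat.multinomial]
    simp only [y₀, multiTerm]
    rw [h1, h2, Nat.cast_one, one_mul, v.map_mul, v.map_pow, hfj, hzk, nsmul_eq_mul]
    push_cast
    ring
  rw [← hval]
  refine v.map_sum_eq_of_lt ?_ ?_ ?_
  · rw [Finset.mem_filter, Finset.mem_sigma, Finset.mem_range, Finset.mem_piAntidiag]
    refine ⟨⟨hjR, ?_, ?_⟩, ?_⟩
    · simp only [y₀]
      rw [Finset.sum_eq_single (p ^ k)]
      · simp
      · intro t _ ht
        exact Pi.single_eq_of_ne ht _
      · exact fun h => absurd hkI h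
    · intro t ht
      by_cases h : t = p ^ k
      · exact h ▸ hkI
      · exact absurd (Pi.single_eq_of_ne h _) ht
    · simp only [y₀]
      rw [Finset.sum_eq_single (p ^ k)]
      · simp [pow_add, mul_comm]
      · intro t _ ht
        simp [Pi.single_eq_of_ne ht]
      · exact fun h => absurd hkI h
  · rw [hval]
    exact WithTop.add_ne_top.2
      ⟨WithTop.mul_ne_top (ENat.natCast_ne_top d) (ENat.natCast_ne_top n), hfin⟩
  · intro y hy hne
    obtain ⟨s, κ⟩ := y
    obtain ⟨hy, hyr⟩ := Finset.mem_filter.1 hy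
    obtain ⟨hys, hyI⟩ := Finset.mem_piAntidiag.1 (Finset.mem_sigma.1 hy).2
    simp only at hys hyI hyr
    obtain ⟨c, t, ht, hk0, hck, hct, hle⟩ := le_map_multiTerm (a := a) (n := n) (N := N) (k := κ)
      hvp hx hz (by rw [hyr]; exact (hpos _).ne')
    rw [hys] at hle
    rw [hyr, padicValNat.prime_pow] at hct
    rw [hval]
    refine lt_of_lt_of_le ?_ hle
    refine (ENat.add_lt_add_iff_left (WithTop.mul_ne_top (ENat.natCast_ne_top d)
      (ENat.natCast_ne_top n))).2 (hlt _ _ hct fun heq => hne ?_)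
    obtain ⟨rfl, hvt⟩ := Prod.mk.inj heq
    have ht0 : ∀ t ∈ I, t ≠ 0 := fun t ht h => hI (h ▸ ht)
    have h1 : p ^ k ≤ t := Nat.le_of_dvd (Nat.pos_of_ne_zero (ht0 t ht))
      ((padicValNat_dvd_iff_le (ht0 t ht)).2 hvt.ge)
    have h2 : p ^ c ≤ κ t := Nat.le_of_dvd (Nat.pos_of_ne_zero hk0) hck
    -- the weight of the single index `t` already is `p ^ (j + k)`
    rw [← Finset.add_sum_erase I _ ht] at hyr
    have h3 : p ^ k * p ^ c ≤ t * p ^ c := Nat.mul_le_mul_right _ h1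
    have h4 : t * p ^ c ≤ t * κ t := Nat.mul_le_mul_left _ h2
    have h5 : p ^ (c + k) = p ^ k * p ^ c := by rw [pow_add, mul_comm]
    have h6 : ∑ t ∈ I.erase t, t * κ t = 0 := by omega
    have h7 : t = p ^ k := Nat.eq_of_mul_eq_mul_right (hpos c) (by omega)
    have h8 : κ t = p ^ c := Nat.eq_of_mul_eq_mul_left (Nat.pos_of_ne_zero (ht0 t ht)) (by omega)
    have h9 : κ = Pi.single (p ^ k) (p ^ c) := by
      funext t'
      by_cases h : t' = t
      · rw [h, h8, h7, Pi.single_eq_same]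
      · rw [Pi.single_eq_of_ne (h7 ▸ h)]
        by_contra h0
        have ht' := hyI t' h0
        have := Finset.sum_eq_zero_iff.1 h6 t' (Finset.mem_erase.2 ⟨h, ht'⟩)
        exact mul_ne_zero (ht0 t' ht') h0 this
    have h10 : s = p ^ c := by
      rw [← hys, h9, Finset.sum_eq_single (p ^ k)]
      · simp
      · intro t _ ht
        exact Pi.single_eq_of_ne ht _
      · exact fun h => absurd hkI h
    rw [h9, h10]

end composite

/-! ### The tower inside one ring -/

section tower

variable {S : Type*} [CommRing S] (v : AddValuation S ℕ∞) {B : Subring S}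

/-- `κ` is the value at `π` of the series `∑ a_h X ^ (h + n)`, whose coefficients in `B` are zero
or units with `a_0 ≠ 0`; convergence is expressed by the partial sums. -/
structure IsUnitExpansion (κ π : S) (n : ℕ) (a : ℕ → B) : Prop where
  coeff : ∀ h, (a h : S) = 0 ∨ v (a h : S) = 0
  zero : (a 0 : S) ≠ 0
  approx : ∀ N : ℕ, (N : ℕ∞) ≤ v (κ - aeval π (truncPoly a n N))

variable {v} {p n m : ℕ} [hp : Fact p.Prime] {e : ℕ∞} {a b c : ℕ → B} {π ϖ κ : S}

/-- Two polynomials over `B` with nearly the same value at `π` have nearly the same shift, up to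
a term beyond the indices of inseparability. -/
theorem le_coeff_mulShift_sub
    (hB : ∀ w ∈ B, 0 < v w → ∀ N : ℕ, ∃ w' ∈ B, (N : ℕ∞) ≤ v (w - p * w'))
    (hQ : ∀ N : ℕ, ∃ Q : B[X], Q.coeff 0 = 0 ∧ (N : ℕ∞) ≤ v (p - aeval κ Q))
    (hπ : v π = 1) (hn : n ≠ 0) (hvp : v (p : S) = e) (hc : IsUnitExpansion v κ π n c) {l : ℕ}
    {g : ℕ∞} (hg : g ≤ n + gap p n e {h | (c h : S) ≠ 0} l) {N : ℕ} {D D' : B[X]}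
    (hD0 : D.coeff 0 = 0) (hD0' : D'.coeff 0 = 0) (hD : (N : ℕ∞) ≤ v (κ - aeval π D))
    (hD' : (N : ℕ∞) ≤ v (κ - aeval π D')) {r : ℕ} (hr : r ≠ 0) (hrl : r ≤ p ^ l) :
    min (g + 1) N ≤ v ((mulShift π D).coeff r - (mulShift π D').coeff r) := by
  obtain ⟨r, rfl⟩ := Nat.exists_eq_succ_of_ne_zero hr
  have h1 : ((mulShift π D).coeff (r + 1) - (mulShift π D').coeff (r + 1)) =
      (mulShift π (D - D')).coeff (r + 1) := by
    simp only [mulShift, map_sub, coeff_sub]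
  rw [Nat.succ_eq_add_one, h1]
  refine (le_coeff_mulShift_of_le_aeval (q := p ^ l) hπ hB (fun N => ?_) N (D - D') ?_).2 ?_ r hrl
  · obtain ⟨Q, hQ0, hQκ⟩ := hQ N
    refine ⟨Q.comp (truncPoly c n N), ?_, ?_, ?_⟩
    · rw [coeff_zero_eq_eval_zero, eval_comp, ← coeff_zero_eq_eval_zero,
        coeff_zero_truncPoly c hn, ← coeff_zero_eq_eval_zero, hQ0]
    · rw [aeval_comp]
      have h2 : (p : S) - aeval (aeval π (truncPoly c n N)) Q = (p - aeval κ Q) +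
        (aeval κ Q - aeval (aeval π (truncPoly c n N)) Q) := by ring
      rw [h2]
      exact v.map_le_add hQκ (le_map_aeval_sub (hc.approx N) Q)
    · intro r hr
      have h2 : ∀ r ≤ p ^ l, g ≤ v ((mulShift π (truncPoly c n N) -
          C ((mulShift π (truncPoly c n N)).coeff 0)).coeff r) := by
        intro r hr
        rcases r with _ | r
        · simp
        · rw [coeff_sub, coeff_C, if_neg (Nat.succ_ne_zero r), sub_zero, coeff_mulShift_truncPoly]
          have h3 := le_map_shiftCoeff (v := v) (p := p) (d := 1) (e := e) (n := n)
            (a := fun h => (c h : S)) (π := π) (by simpa using hvp) (by simpa using hπ) N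
            (Nat.succ_ne_zero r)
          rw [Nat.cast_one, one_mul] at h3
          refine hg.trans (le_trans ?_ h3)
          gcongr
          refine gap_antitone ?_
          rw [← Nat.pow_le_pow_iff_right hp.out.one_lt]
          exact (Nat.le_of_dvd (Nat.succ_pos r) pow_padicValNat_dvd).trans hr
      have h4 := le_coeff_aeval_sub h2 Q (r + 1) hr
      have h5 : mulShift π (Q.comp (truncPoly c n N)) =
          aeval (mulShift π (truncPoly c n N)) Q := by
        rw [mulShift, aeval_comp, ← mulShift]
      have h6 : aeval (C ((mulShift π (truncPoly c n N)).coeff 0)) Q =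
          C (aeval ((mulShift π (truncPoly c n N)).coeff 0) Q) := by
        have := aeval_algebraMap_apply S[X] ((mulShift π (truncPoly c n N)).coeff 0) Q
        exact this
      rw [h6, ← h5, coeff_sub, coeff_C, if_neg (Nat.succ_ne_zero r), sub_zero] at h4
      exact h4
  · rw [map_sub]
    have h2 : aeval π D - aeval π D' = (κ - aeval π D') - (κ - aeval π D) := by ring
    rw [h2]
    exact AddValuation.le_map_sub hD' hD
  · rw [coeff_sub, hD0, hD0', sub_zero]

/-- The shift of the expansion of `ϖ` has the form `ϖ (1 + ∑ z_t Y ^ t)`, up to a small constant,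
with `z_t` bounded from below by the indices of inseparability. -/
theorem exists_mulShift_eq (hdvd : ∀ x y : S, v x ≤ v y → x ∣ y) (hπ : v π = 1) (hϖ : v ϖ = m)
    (hvp : v (p : S) = e) (N : ℕ) :
    ∃ z : ℕ → S,
      (∀ t, t ≠ 0 → ϖ * z t = shiftCoeff (fun h => (b h : S)) m N π t) ∧
      (∀ t ∈ Finset.Ico 1 (N + m), gap p m e {h | (b h : S) ≠ 0} (padicValNat p t) ≤ v (z t)) ∧
      mulShift π (truncPoly b m N) = C (aeval π (truncPoly b m N) - ϖ) +
        C ϖ * (1 + ∑ t ∈ Finset.Ico 1 (N + m), C (z t) * X ^ t) := by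
  have hle : ∀ t, t ≠ 0 → (m : ℕ∞) + gap p m e {h | (b h : S) ≠ 0} (padicValNat p t) ≤
      v (shiftCoeff (fun h => (b h : S)) m N π t) := by
    intro t ht
    have h3 := le_map_shiftCoeff (v := v) (p := p) (d := 1) (e := e) (n := m)
      (a := fun h => (b h : S)) (π := π) (by simpa using hvp) (by simpa using hπ) N ht
    rwa [Nat.cast_one, one_mul] at h3
  have hz : ∀ t, ∃ z, t ≠ 0 → ϖ * z = shiftCoeff (fun h => (b h : S)) m N π t := by
    intro t
    by_cases ht : t = 0
    · exact ⟨0, fun h => absurd ht h⟩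
    · obtain ⟨z, hz⟩ := hdvd ϖ _ (hϖ ▸ le_self_add.trans (hle t ht))
      exact ⟨z, fun _ => hz.symm⟩
  choose z hz using hz
  refine ⟨z, hz, fun t ht => ?_, ?_⟩
  · have ht0 : t ≠ 0 := by
      have := (Finset.mem_Ico.1 ht).1
      omega
    have h1 := hle t ht0
    rw [← hz t ht0, v.map_mul, hϖ] at h1
    exact (ENat.add_le_add_iff_left (ENat.natCast_ne_top m)).1 h1
  · ext r
    rw [mul_add, mul_one, Finset.mul_sum]
    simp only [coeff_add, finsetSum_coeff, ← mul_assoc, ← C_mul, coeff_C_mul, coeff_X_pow, coeff_C]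
    by_cases hr0 : r = 0
    · subst hr0
      rw [Finset.sum_eq_zero, coeff_zero_mulShift]
      · simp
      · intro t ht
        have := (Finset.mem_Ico.1 ht).1
        rw [if_neg (by omega), mul_zero]
    · rw [if_neg hr0, if_neg hr0, zero_add, zero_add, coeff_mulShift_truncPoly]
      by_cases hr : r < N + m
      · rw [Finset.sum_eq_single r]
        · rw [if_pos rfl, mul_one, hz r hr0]
        · intro t _ ht
          rw [if_neg ht.symm, mul_zero]
        · intro h
          exact absurd (Finset.mem_Ico.2 ⟨by omega, hr⟩) h
      · rw [Finset.sum_eq_zero]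
        · refine Finset.sum_eq_zero fun i hi => ?_
          rw [Finset.mem_range] at hi
          rw [Nat.choose_eq_zero_of_lt (by omega)]
          simp
        · intro t ht
          have := (Finset.mem_Ico.1 ht).2
          rw [if_neg (by omega), mul_zero]

/-- The shift of the composite of two expansions, up to precision `N`. -/
theorem le_coeff_mulShift_comp_sub {I : Finset ℕ} {z : ℕ → S} {N : ℕ} {G : B[X]}
    (hG : (N : ℕ∞) ≤ v (ϖ - aeval π G))
    (hz : mulShift π G = C (aeval π G - ϖ) + C ϖ * (1 + ∑ t ∈ I, C (z t) * X ^ t)) (r : ℕ) :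
    (N : ℕ∞) ≤ v ((mulShift π ((truncPoly a n N).comp G)).coeff r -
      (∑ s ∈ Finset.range (N + n), C (shiftCoeff (fun h => (a h : S)) n N ϖ s) *
        (∑ t ∈ I, C (z t) * X ^ t) ^ s).coeff r) := by
  rw [mulShift, aeval_comp, ← mulShift, ← aeval_truncPoly_mul_one_add, ← coeff_sub]
  refine le_coeff_aeval_sub (q := r) (fun i _ => ?_) _ r le_rfl
  rw [hz, add_sub_cancel_right, coeff_C]
  split_ifs
  · rw [← v.map_neg, neg_sub]
    exact hG
  · simp

/-- The lower bound for the indices of inseparability of a tower. -/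
theorem le_gap_tower (hdvd : ∀ x y : S, v x ≤ v y → x ∣ y)
    (hB : ∀ w ∈ B, 0 < v w → ∀ N : ℕ, ∃ w' ∈ B, (N : ℕ∞) ≤ v (w - p * w'))
    (hQ : ∀ N : ℕ, ∃ Q : B[X], Q.coeff 0 = 0 ∧ (N : ℕ∞) ≤ v (p - aeval κ Q))
    (hπ : v π = 1) (hϖ : v ϖ = m) (hn : n ≠ 0) (hm : m ≠ 0) (he : e ≠ 0)
    (hvp : v (p : S) = m * (n * e))
    (ha : IsUnitExpansion v κ ϖ n a) (hb : IsUnitExpansion v ϖ π m b)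
    (hc : IsUnitExpansion v κ π (n * m) c) {l : ℕ} (hl : l ≤ padicValNat p (n * m)) {β : ℕ∞}
    (hβ : ∀ j k, j + k ≤ l → β ≤ m * gap p n (n * e) {h | (a h : S) ≠ 0} j +
      (p : ℕ∞) ^ j * gap p m (m * (n * e)) {h | (b h : S) ≠ 0} k) :
    β ≤ gap p (n * m) (m * (n * e)) {h | (c h : S) ≠ 0} l := by
  classical
  set A'' := {h | (c h : S) ≠ 0}
  set i'' := gap p (n * m) (m * (n * e)) A''
  by_cases htop : i'' l = ⊤
  · rw [htop]; exact le_top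
  have hnm : n * m ≠ 0 := mul_ne_zero hn hm
  -- for the least `j` with `i''_j = i''_l`, this index is the valuation of the coefficient of
  -- `Y ^ (p ^ j)`
  obtain ⟨j, hjl, hj, hjmin⟩ : ∃ j ≤ l, i'' j = i'' l ∧ ∀ j' < j, i'' j < i'' j' := by
    have hex : ∃ j, i'' j = i'' l := ⟨l, rfl⟩
    refine ⟨Nat.find hex, Nat.find_min' hex rfl, Nat.find_spec hex, fun j' hj' => ?_⟩
    refine lt_of_le_of_ne (gap_antitone hj'.le) fun h => ?_
    exact Nat.find_min hex hj' (h.symm.trans (Nat.find_spec hex))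
  obtain ⟨N, hN⟩ : ∃ N : ℕ, ((n * m : ℕ) : ℕ∞) + i'' l + 1 = N := by
    refine ⟨((n * m : ℕ) + i'' l + 1 : ℕ∞).toNat, (ENat.natCast_toNat ?_).symm⟩
    exact WithTop.add_ne_top.2 ⟨WithTop.add_ne_top.2 ⟨ENat.natCast_ne_top _, htop⟩,
      ENat.natCast_ne_top 1⟩
  have hiN : i'' l < N := by
    rw [← hN, Order.lt_add_one_iff_of_not_isMax]
    · exact le_add_self
    · rw [isMax_iff_eq_top]
      exact WithTop.add_ne_top.2 ⟨ENat.natCast_ne_top _, htop⟩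
  have hvp0 : v (p : S) ≠ 0 := by
    rw [hvp]
    exact mul_ne_zero (by exact_mod_cast hm) (mul_ne_zero (by exact_mod_cast hn) he)
  have hH := map_shiftCoeff_prime_pow (v := v) (p := p) (d := 1) (e := m * (n * e)) (n := n * m)
    (a := fun h => (c h : S)) (π := π) (j := j) (N := N) (by simpa using hvp) hvp0 one_ne_zero
    (by simpa using hπ) hnm ⟨e, by push_cast; ring⟩ hc.coeff hc.zero (hjl.trans hl) hjmin
    (by change i'' j < N; rwa [hj])
  change _ = (1 : ℕ) * (((n * m : ℕ) : ℕ∞) + i'' j) at hH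
  rw [hj, Nat.cast_one, one_mul] at hH
  set G := truncPoly b m N
  set F := truncPoly a n N
  have hr0 : p ^ j ≠ 0 := (pow_pos hp.out.pos j).ne'
  obtain ⟨z, -, hz, hGz⟩ := exists_mulShift_eq (b := b) (p := p) hdvd hπ hϖ hvp N
  have h1 := le_map_coeff_composite (a := fun h => (a h : S)) (n := n) (N := N) hvp hϖ hz hβ
    hr0 (by rwa [padicValNat.prime_pow]) (N + n)
  have h2 := le_coeff_mulShift_comp_sub (a := a) (n := n) (hb.approx N) hGz (p ^ j)
  have h3 : min (((n * m : ℕ) : ℕ∞) + i'' l + 1) (N : ℕ∞) ≤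
      v ((mulShift π (F.comp G)).coeff (p ^ j) -
        (mulShift π (truncPoly c (n * m) N)).coeff (p ^ j)) := by
    refine le_coeff_mulShift_sub hB hQ hπ hnm hvp hc le_rfl ?_ (coeff_zero_truncPoly c hnm N) ?_
      (hc.approx N) hr0 (Nat.pow_le_pow_right hp.out.pos hjl)
    · rw [coeff_zero_eq_eval_zero, eval_comp, ← coeff_zero_eq_eval_zero G,
        coeff_zero_truncPoly b hm, ← coeff_zero_eq_eval_zero, coeff_zero_truncPoly a hn]
    · rw [aeval_comp]
      have h4 : κ - aeval (aeval π G) F = (κ - aeval ϖ F) + (aeval ϖ F - aeval (aeval π G) F) := by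
        ring
      rw [h4]
      exact v.map_le_add (ha.approx N) (le_map_aeval_sub (hb.approx N) F)
  rw [hN, min_self] at h3
  rw [coeff_mulShift_truncPoly] at h3
  set x := (mulShift π (F.comp G)).coeff (p ^ j)
  set y := shiftCoeff (fun h => (c h : S)) (n * m) N π (p ^ j)
  have h5 : min (m * n + β) (N : ℕ∞) ≤ v y := by
    rw [← sub_sub_cancel x y]
    refine AddValuation.le_map_sub ?_ ((min_le_right _ _).trans h3)
    rw [← sub_add_cancel x (Polynomial.coeff _ (p ^ j))]
    exact v.map_le_add ((min_le_right _ _).trans h2) ((min_le_left _ _).trans h1)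
  rw [hH] at h5
  rcases min_le_iff.1 h5 with h6 | h6
  · have h7 : ((n * m : ℕ) : ℕ∞) = m * n := by push_cast; ring
    rw [h7] at h6
    exact (ENat.add_le_add_iff_left (by rw [← h7]; exact ENat.natCast_ne_top _)).1 h6
  · exfalso
    rw [← hN] at h6
    refine absurd h6 (not_le.2 ?_)
    rw [Order.lt_add_one_iff_of_not_isMax]
    rw [isMax_iff_eq_top]
    exact WithTop.add_ne_top.2 ⟨ENat.natCast_ne_top _, htop⟩

/-- The lower bound of `le_gap_tower` is attained if its minimum is attained only once. -/
theorem gap_tower_le (hdvd : ∀ x y : S, v x ≤ v y → x ∣ y)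
    (hB : ∀ w ∈ B, 0 < v w → ∀ N : ℕ, ∃ w' ∈ B, (N : ℕ∞) ≤ v (w - p * w'))
    (hQ : ∀ N : ℕ, ∃ Q : B[X], Q.coeff 0 = 0 ∧ (N : ℕ∞) ≤ v (p - aeval κ Q))
    (hπ : v π = 1) (hϖ : v ϖ = m) (hn : n ≠ 0) (hm : m ≠ 0) (he : e ≠ 0)
    (hvp : v (p : S) = m * (n * e))
    (ha : IsUnitExpansion v κ ϖ n a) (hb : IsUnitExpansion v ϖ π m b)
    (hc : IsUnitExpansion v κ π (n * m) c) {j k : ℕ} (hj : j ≤ padicValNat p n)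
    (hk : k ≤ padicValNat p m)
    (hlt : ∀ j' k', j' + k' ≤ j + k → (j', k') ≠ (j, k) →
      m * gap p n (n * e) {h | (a h : S) ≠ 0} j +
          (p : ℕ∞) ^ j * gap p m (m * (n * e)) {h | (b h : S) ≠ 0} k <
        m * gap p n (n * e) {h | (a h : S) ≠ 0} j' +
          (p : ℕ∞) ^ j' * gap p m (m * (n * e)) {h | (b h : S) ≠ 0} k') :
    gap p (n * m) (m * (n * e)) {h | (c h : S) ≠ 0} (j + k) ≤
      m * gap p n (n * e) {h | (a h : S) ≠ 0} j +
          (p : ℕ∞) ^ j * gap p m (m * (n * e)) {h | (b h : S) ≠ 0} k := by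
  set i := gap p n (n * e) {h | (a h : S) ≠ 0}
  set i' := gap p m (m * (n * e)) {h | (b h : S) ≠ 0}
  set i'' := gap p (n * m) (m * (n * e)) {h | (c h : S) ≠ 0}
  by_contra! hcon
  set β := m * i j + (p : ℕ∞) ^ j * i' k
  have hβ : β ≠ ⊤ := ne_top_of_lt hcon
  have hpos : ∀ t, 0 < p ^ t := fun t => pow_pos hp.out.pos t
  have hnm : n * m ≠ 0 := mul_ne_zero hn hm
  have hnm' : ((n * m : ℕ) : ℕ∞) = m * n := by push_cast; ring
  have hvp0 : v (p : S) ≠ 0 := by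
    rw [hvp]
    exact mul_ne_zero (by exact_mod_cast hm) (mul_ne_zero (by exact_mod_cast hn) he)
  have hm' : (m : ℕ∞) ≠ 0 := by exact_mod_cast hm
  have hpj : (p : ℕ∞) ^ j ≠ 0 := by exact_mod_cast (hpos j).ne'
  have hi : i j ≠ ⊤ := by
    intro h
    refine hβ ?_
    simp only [β]
    rw [h, ENat.mul_top hm', top_add]
  have hi' : i' k ≠ ⊤ := by
    intro h
    refine hβ ?_
    simp only [β]
    rw [h, ENat.mul_top hpj, add_top]
  have hilt : ∀ j' < j, i j < i j' := by
    intro j' hj'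
    have h1 := hlt j' k (by omega) (by simp [hj'.ne])
    by_contra! h2
    refine absurd h1 (not_lt.2 ?_)
    change _ ≤ m * i j + (p : ℕ∞) ^ j * i' k
    gcongr
    exact_mod_cast hp.out.one_le
  have hilt' : ∀ k' < k, i' k < i' k' := by
    intro k' hk'
    have h1 := hlt j k' (by omega) (by simp [hk'.ne])
    by_contra! h2
    refine absurd h1 (not_lt.2 ?_)
    change _ ≤ m * i j + (p : ℕ∞) ^ j * i' k
    gcongr
  -- a precision beyond the common value `n m + β`, both indices, and the places `p ^ j`, `p ^ k`
  obtain ⟨N, hN⟩ : ∃ N : ℕ, ((n * m : ℕ) : ℕ∞) + β + 1 + i j + i' k + 1 + p ^ j + p ^ k = N := by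
    refine ⟨((n * m : ℕ) + β + 1 + i j + i' k + 1 + p ^ j + p ^ k : ℕ∞).toNat,
      (ENat.natCast_toNat ?_).symm⟩
    simp [hβ, hi, hi', ENat.add_eq_top, ENat.pow_eq_top_iff]
    exact_mod_cast ENat.natCast_ne_top (n * m)
  have hmono : ∀ x : ℕ∞, x ≠ ⊤ → x + 1 ≤ N → x < N := fun x hx h =>
    (ENat.add_one_le_iff hx).1 h
  have hiN : i j < N := hmono _ hi <| by
    rw [← hN]
    calc i j + 1 ≤ (((n * m : ℕ) : ℕ∞) + β + 1 + i' k + p ^ j + p ^ k) + (i j + 1) := le_add_self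
      _ = _ := by ring
  have hiN' : i' k < N := hmono _ hi' <| by
    rw [← hN]
    calc i' k + 1 ≤ (((n * m : ℕ) : ℕ∞) + β + 1 + i j + p ^ j + p ^ k) + (i' k + 1) := le_add_self
      _ = _ := by ring
  have hβN : ((n * m : ℕ) : ℕ∞) + β + 1 ≤ N := by
    rw [← hN]
    calc ((n * m : ℕ) : ℕ∞) + β + 1 ≤
        (((n * m : ℕ) : ℕ∞) + β + 1) + (i j + i' k + 1 + p ^ j + p ^ k) := le_self_add
      _ = _ := by ring
  have hpjN : p ^ j < N := by
    have : ((p ^ j : ℕ) : ℕ∞) + 1 ≤ N := by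
      rw [← hN]
      push_cast
      calc (p : ℕ∞) ^ j + 1 ≤ ((n * m : ℕ∞) + β + 1 + i j + i' k + p ^ k) + ((p : ℕ∞) ^ j + 1) :=
            le_add_self
        _ = _ := by ring
    exact_mod_cast this
  have hpkN : p ^ k < N := by
    have : ((p ^ k : ℕ) : ℕ∞) + 1 ≤ N := by
      rw [← hN]
      push_cast
      calc (p : ℕ∞) ^ k + 1 ≤ ((n * m : ℕ∞) + β + 1 + i j + i' k + p ^ j) + ((p : ℕ∞) ^ k + 1) :=
            le_add_self
        _ = _ := by ring
    exact_mod_cast this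
  set G := truncPoly b m N
  set F := truncPoly a n N
  have hr0 : p ^ (j + k) ≠ 0 := (hpos _).ne'
  obtain ⟨z, hzeq, hz, hGz⟩ := exists_mulShift_eq (b := b) (p := p) hdvd hπ hϖ hvp N
  have hfj : v (shiftCoeff (fun h => (a h : S)) n N ϖ (p ^ j)) = m * (n + i j) :=
    map_shiftCoeff_prime_pow hvp hvp0 hm hϖ hn ⟨e, rfl⟩ ha.coeff ha.zero hj hilt hiN
  have hzk : v (z (p ^ k)) = i' k := by
    have h1 := map_shiftCoeff_prime_pow (v := v) (p := p) (d := 1) (e := m * (n * e)) (n := m)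
      (a := fun h => (b h : S)) (π := π) (j := k) (N := N) (by simpa using hvp) hvp0 one_ne_zero
      (by simpa using hπ) hm ⟨n * e, rfl⟩ hb.coeff hb.zero hk hilt' hiN'
    rw [← hzeq _ (hpos k).ne', v.map_mul, hϖ, Nat.cast_one, one_mul] at h1
    exact ENat.add_right_injective_of_ne_top (ENat.natCast_ne_top m) h1
  have h1 := map_coeff_composite_eq (a := fun h => (a h : S)) (n := n) (N := N) (R := N + n)
    hvp hϖ hz (by simp) hlt hβ (Finset.mem_Ico.2 ⟨hpos k, by omega⟩) (by omega) hfj hzk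
  have h2 := le_coeff_mulShift_comp_sub (a := a) (n := n) (hb.approx N) hGz (p ^ (j + k))
  have h3 : min (((n * m : ℕ) : ℕ∞) + β + 1) (N : ℕ∞) ≤
      v ((mulShift π (F.comp G)).coeff (p ^ (j + k)) -
        (mulShift π (truncPoly c (n * m) N)).coeff (p ^ (j + k))) := by
    refine le_coeff_mulShift_sub (l := j + k) hB hQ hπ hnm hvp hc ?_ ?_
      (coeff_zero_truncPoly c hnm N) ?_ (hc.approx N) hr0 le_rfl
    · gcongr
    · rw [coeff_zero_eq_eval_zero, eval_comp, ← coeff_zero_eq_eval_zero G,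
        coeff_zero_truncPoly b hm, ← coeff_zero_eq_eval_zero, coeff_zero_truncPoly a hn]
    · rw [aeval_comp]
      have h4 : κ - aeval (aeval π G) F = (κ - aeval ϖ F) + (aeval ϖ F - aeval (aeval π G) F) := by
        ring
      rw [h4]
      exact v.map_le_add (ha.approx N) (le_map_aeval_sub (hb.approx N) F)
  have h4 : ((n * m : ℕ) : ℕ∞) + β + 1 ≤
      v ((mulShift π (truncPoly c (n * m) N)).coeff (p ^ (j + k))) := by
    rw [coeff_mulShift_truncPoly]
    have h5 := le_map_shiftCoeff (v := v) (p := p) (d := 1) (e := m * (n * e)) (n := n * m)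
      (a := fun h => (c h : S)) (π := π) (by simpa using hvp) (by simpa using hπ) N hr0
    rw [padicValNat.prime_pow, Nat.cast_one, one_mul] at h5
    refine le_trans ?_ h5
    rw [add_assoc]
    gcongr
    exact (ENat.add_one_le_iff hβ).2 hcon
  rw [min_eq_left hβN] at h3
  have h5 := AddValuation.le_map_sub (v.map_le_add h3 h4) (hβN.trans h2)
  rw [sub_add_cancel, sub_sub_cancel, h1, hnm'] at h5
  refine absurd h5 (not_le.2 ((ENat.lt_add_one_iff ?_).2 le_rfl))
  exact WithTop.add_ne_top.2 ⟨by rw [← hnm']; exact ENat.natCast_ne_top _, hβ⟩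

end tower

/-! ### Teichmüller representatives as elements with all `p ^ s`-th roots -/

section rootsSubmonoid

variable {S : Type*} [CommRing S] (p : ℕ)

/-- The elements that are `p ^ s`-th powers for all `s`. In the valuation ring of a local field
with perfect residue field of characteristic `p`, these are the Teichmüller representatives. -/
def infinitePowers (S : Type*) [CommRing S] (p : ℕ) : Submonoid S where
  carrier := {x | ∀ s : ℕ, ∃ y, y ^ p ^ s = x}
  one_mem' s := ⟨1, one_pow _⟩
  mul_mem' {x y} hx hy s := by
    obtain ⟨x', hx'⟩ := hx s
    obtain ⟨y', hy'⟩ := hy s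
    exact ⟨x' * y', by rw [mul_pow, hx', hy']⟩

theorem map_mem_infinitePowers {S' : Type*} [CommRing S'] (φ : S →+* S') {x : S}
    (hx : x ∈ infinitePowers S p) : φ x ∈ infinitePowers S' p := fun s => by
  obtain ⟨y, hy⟩ := hx s
  exact ⟨φ y, by rw [← map_pow, hy]⟩

variable {p} [hp : Fact p.Prime] {v : AddValuation S ℕ∞}

theorem zero_mem_infinitePowers : (0 : S) ∈ infinitePowers S p := fun s =>
  ⟨0, zero_pow (pow_pos hp.out.pos s).ne'⟩

/-- Raising to the power `p` makes congruent elements more congruent. -/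
theorem add_one_le_map_pow_prime_sub (hvp : v (p : S) ≠ 0) {x y : S} {c : ℕ∞} (hc : 1 ≤ c)
    (h : c ≤ v (x - y)) : c + 1 ≤ v (x ^ p - y ^ p) := by
  obtain ⟨r, hr⟩ := exists_add_pow_prime_eq hp.out (x - y) y
  rw [sub_add_cancel] at hr
  have h1 : x ^ p - y ^ p = (x - y) ^ p + (x - y) * (p * y * r) := by rw [hr]; ring
  rw [h1]
  refine v.map_le_add ?_ ?_
  · rw [v.map_pow, nsmul_eq_mul]
    calc c + 1 ≤ c + c := by gcongr
      _ = 2 * c := (two_mul c).symm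
      _ ≤ p * v (x - y) := by
        gcongr
        exact_mod_cast hp.out.two_le
  · rw [v.map_mul, v.map_mul, v.map_mul]
    refine add_le_add h ?_
    exact (Order.one_le_iff_ne_zero.2 hvp).trans (le_self_add.trans le_self_add)

theorem add_one_le_map_pow_prime_pow_sub (hvp : v (p : S) ≠ 0) {x y : S} (h : 0 < v (x - y))
    (s : ℕ) : (s : ℕ∞) + 1 ≤ v (x ^ p ^ s - y ^ p ^ s) := by
  induction s with
  | zero => simpa using Order.one_le_iff_pos.2 h
  | succ s ih =>
    rw [pow_succ, pow_mul, pow_mul, Nat.cast_add, Nat.cast_one]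
    exact add_one_le_map_pow_prime_sub hvp le_add_self ih

theorem map_sub_pos_of_map_pow_prime_pow_sub_pos (hvp : v (p : S) ≠ 0) {x y : S} {s : ℕ}
    (h : 0 < v (x ^ p ^ s - y ^ p ^ s)) : 0 < v (x - y) := by
  induction s with
  | zero => simpa using h
  | succ s ih =>
    refine ih ?_
    rw [pow_succ, pow_mul, pow_mul] at h
    set a := x ^ p ^ s
    set b := y ^ p ^ s
    obtain ⟨r, hr⟩ := exists_add_pow_prime_eq hp.out (a - b) b
    rw [sub_add_cancel] at hr
    have h1 : (a - b) ^ p = (a ^ p - b ^ p) - p * ((a - b) * b * r) := by rw [hr]; ring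
    have h2 : 1 ≤ v ((a - b) ^ p) := by
      rw [h1]
      refine AddValuation.le_map_sub (Order.one_le_iff_pos.2 h) ?_
      rw [v.map_mul]
      exact (Order.one_le_iff_ne_zero.2 hvp).trans le_self_add
    rw [v.map_pow, nsmul_eq_mul] at h2
    rw [pos_iff_ne_zero]
    intro h3
    rw [h3, mul_zero] at h2
    simp at h2

/-- Elements with all `p ^ s`-th roots are determined by their residues. -/
theorem eq_of_mem_infinitePowers (hvp : v (p : S) ≠ 0) (htop : ∀ x, v x = ⊤ → x = 0) {x y : S}
    (hx : x ∈ infinitePowers S p) (hy : y ∈ infinitePowers S p) (h : 0 < v (x - y)) : x = y := by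
  refine sub_eq_zero.1 (htop _ (ENat.eq_top_iff_forall_ge.2 fun s => ?_))
  obtain ⟨x', rfl⟩ := hx s
  obtain ⟨y', rfl⟩ := hy s
  exact le_self_add.trans
    (add_one_le_map_pow_prime_pow_sub hvp (map_sub_pos_of_map_pow_prime_pow_sub_pos hvp h) s)

theorem eq_zero_or_map_eq_zero_of_mem_infinitePowers (hvp : v (p : S) ≠ 0)
    (htop : ∀ x, v x = ⊤ → x = 0) {x : S} (hx : x ∈ infinitePowers S p) : x = 0 ∨ v x = 0 := by
  by_cases h : v x = 0
  · exact Or.inr h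
  · refine Or.inl (eq_of_mem_infinitePowers hvp htop hx zero_mem_infinitePowers ?_)
    rw [sub_zero]
    exact pos_iff_ne_zero.2 h

/-- If all residues have representatives with `p ^ s`-th roots for all `s`, these representatives
have `p ^ s`-th roots of the same kind. -/
theorem exists_root_mem_infinitePowers (hvp : v (p : S) ≠ 0) (htop : ∀ x, v x = ⊤ → x = 0)
    (hT : ∀ x : S, ∃ t ∈ infinitePowers S p, 0 < v (x - t)) {x : S}
    (hx : x ∈ infinitePowers S p) (s : ℕ) : ∃ y ∈ infinitePowers S p, y ^ p ^ s = x := by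
  obtain ⟨y, hy⟩ := hx s
  obtain ⟨t, ht, hyt⟩ := hT y
  refine ⟨t, ht, (eq_of_mem_infinitePowers hvp htop hx (pow_mem ht _) ?_).symm⟩
  rw [← hy]
  exact lt_of_lt_of_le (by simp) (add_one_le_map_pow_prime_pow_sub hvp hyt s)

/-- Approximately, the subring generated by the Teichmüller representatives is the sum of these
and of its multiples of `p`. The sum of two representatives is treated by taking `p ^ N`-th roots,
applying the binomial theorem and raising the representative of the sum of the roots to the power
`p ^ N`. -/
theorem exists_approx_of_mem_closure_infinitePowers (hvp : v (p : S) ≠ 0)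
    (htop : ∀ x, v x = ⊤ → x = 0) (hT : ∀ x : S, ∃ t ∈ infinitePowers S p, 0 < v (x - t))
    {w : S} (hw : w ∈ Subring.closure (infinitePowers S p : Set S)) (N : ℕ) :
    ∃ t ∈ infinitePowers S p, ∃ w' ∈ Subring.closure (infinitePowers S p : Set S),
      (N : ℕ∞) ≤ v (w - t - p * w') := by
  set B := Subring.closure (infinitePowers S p : Set S)
  have hTB : ∀ t ∈ infinitePowers S p, t ∈ B := fun t ht => Subring.subset_closure ht
  have hadd : ∀ t₁ ∈ infinitePowers S p, ∀ t₂ ∈ infinitePowers S p,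
      ∃ t ∈ infinitePowers S p, ∃ w' ∈ B, (N : ℕ∞) ≤ v (t₁ + t₂ - t - p * w') := by
    intro t₁ ht₁ t₂ ht₂
    obtain ⟨y₁, hy₁, rfl⟩ := exists_root_mem_infinitePowers hvp htop hT ht₁ N
    obtain ⟨y₂, hy₂, rfl⟩ := exists_root_mem_infinitePowers hvp htop hT ht₂ N
    obtain ⟨t, ht, hyt⟩ := hT (y₁ + y₂)
    obtain ⟨r, hr⟩ := exists_add_pow_prime_pow_eq hp.out (⟨y₁, hTB _ hy₁⟩ : B) ⟨y₂, hTB _ hy₂⟩ N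
    refine ⟨t ^ p ^ N, pow_mem ht _, -(y₁ * y₂ * r),
      neg_mem (mul_mem (mul_mem (hTB _ hy₁) (hTB _ hy₂)) r.2), ?_⟩
    have hr' := congrArg (fun b : B => (b : S)) hr
    push_cast at hr'
    have h1 : y₁ ^ p ^ N + y₂ ^ p ^ N - t ^ p ^ N - p * -(y₁ * y₂ * r) =
        (y₁ + y₂) ^ p ^ N - t ^ p ^ N := by
      rw [hr']; ring
    rw [h1]
    exact le_self_add.trans (add_one_le_map_pow_prime_pow_sub hvp hyt N)
  induction hw using Subring.closure_induction with
  | mem x hx => exact ⟨x, hx, 0, zero_mem _, by simp⟩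
  | zero => exact ⟨0, zero_mem_infinitePowers, 0, zero_mem _, by simp⟩
  | one => exact ⟨1, one_mem _, 0, zero_mem _, by simp⟩
  | add x y _ _ hx hy =>
    obtain ⟨t₁, ht₁, w₁, hw₁, h₁⟩ := hx
    obtain ⟨t₂, ht₂, w₂, hw₂, h₂⟩ := hy
    obtain ⟨t, ht, w, hw, h⟩ := hadd t₁ ht₁ t₂ ht₂
    refine ⟨t, ht, w₁ + w₂ + w, add_mem (add_mem hw₁ hw₂) hw, ?_⟩
    have h3 : x + y - t - p * (w₁ + w₂ + w) =
        (x - t₁ - p * w₁) + (y - t₂ - p * w₂) + (t₁ + t₂ - t - p * w) := by ring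
    rw [h3]
    exact v.map_le_add (v.map_le_add h₁ h₂) h
  | neg x _ hx =>
    obtain ⟨t₁, ht₁, w₁, hw₁, h₁⟩ := hx
    obtain ⟨t₂, ht₂, hlt⟩ := hT (-t₁)
    obtain ⟨t, ht, w, hw, h⟩ := hadd t₁ ht₁ t₂ ht₂
    by_cases hN : N = 0
    · exact ⟨0, zero_mem_infinitePowers, 0, zero_mem _, by simp [hN]⟩
    have ht0 : t = 0 := by
      refine eq_of_mem_infinitePowers hvp htop ht zero_mem_infinitePowers ?_
      rw [sub_zero, ← Order.one_le_iff_pos]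
      have h3 : t = -(-t₁ - t₂) - (t₁ + t₂ - t - p * w) - p * w := by ring
      rw [h3]
      refine AddValuation.le_map_sub (AddValuation.le_map_sub ?_ ?_) ?_
      · rw [v.map_neg]
        exact Order.one_le_iff_pos.2 hlt
      · refine le_trans ?_ h
        exact_mod_cast Nat.one_le_iff_ne_zero.2 hN
      · rw [v.map_mul]
        exact (Order.one_le_iff_ne_zero.2 hvp).trans le_self_add
    refine ⟨t₂, ht₂, -w₁ - w, sub_mem (neg_mem hw₁) hw, ?_⟩
    have h3 : -x - t₂ - p * (-w₁ - w) = -(x - t₁ - p * w₁) - (t₁ + t₂ - t - p * w) := by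
      rw [ht0]; ring
    rw [h3]
    refine AddValuation.le_map_sub ?_ h
    rwa [v.map_neg]
  | mul x y hx' hy' hx hy =>
    obtain ⟨t₁, ht₁, w₁, hw₁, h₁⟩ := hx
    obtain ⟨t₂, ht₂, w₂, hw₂, h₂⟩ := hy
    refine ⟨t₁ * t₂, mul_mem ht₁ ht₂, t₁ * w₂ + w₁ * y,
      add_mem (mul_mem (hTB _ ht₁) hw₂) (mul_mem hw₁ hy'), ?_⟩
    have h3 : x * y - t₁ * t₂ - p * (t₁ * w₂ + w₁ * y) =
        (x - t₁ - p * w₁) * y + t₁ * (y - t₂ - p * w₂) := by ring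
    rw [h3]
    refine v.map_le_add ?_ ?_ <;> rw [v.map_mul]
    · exact h₁.trans le_self_add
    · exact h₂.trans le_add_self

/-- In the subring generated by the Teichmüller representatives, the elements of positive valuation
are approximately multiples of `p`, however ramified the valuation is. -/
theorem exists_approx_prime_mul (hvp : v (p : S) ≠ 0)
    (htop : ∀ x, v x = ⊤ → x = 0) (hT : ∀ x : S, ∃ t ∈ infinitePowers S p, 0 < v (x - t)) :
    ∀ w ∈ Subring.closure (infinitePowers S p : Set S), 0 < v w → ∀ N : ℕ,
      ∃ w' ∈ Subring.closure (infinitePowers S p : Set S), (N : ℕ∞) ≤ v (w - p * w') := by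
  intro w hw hw0 N
  by_cases hN : N = 0
  · exact ⟨0, zero_mem _, by simp [hN]⟩
  obtain ⟨t, ht, w', hw', h⟩ := exists_approx_of_mem_closure_infinitePowers hvp htop hT hw N
  have ht0 : t = 0 := by
    refine eq_of_mem_infinitePowers hvp htop ht zero_mem_infinitePowers ?_
    rw [sub_zero, ← Order.one_le_iff_pos]
    have h3 : t = w - (w - t - p * w') - p * w' := by ring
    rw [h3]
    refine AddValuation.le_map_sub (AddValuation.le_map_sub (Order.one_le_iff_pos.2 hw0) ?_) ?_
    · refine le_trans ?_ h
      exact_mod_cast Nat.one_le_iff_ne_zero.2 hN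
    · rw [v.map_mul]
      exact (Order.one_le_iff_ne_zero.2 hvp).trans le_self_add
  exact ⟨w', hw', by simpa [ht0] using h⟩

end rootsSubmonoid

/-- The digit expansion of `x` in powers of `π`, with digits in a set `T` that represents all
residues. -/
theorem exists_digits {S : Type*} [CommRing S] {v : AddValuation S ℕ∞}
    (hdvd : ∀ x y : S, v x ≤ v y → x ∣ y) {T : Set S}
    (hT : ∀ x : S, ∃ t ∈ T, 0 < v (x - t)) {π : S} (hπ : v π = 1) (x : S) :
    ∃ a : ℕ → S, (∀ h, a h ∈ T) ∧
      ∀ N : ℕ, (N : ℕ∞) ≤ v (x - ∑ h ∈ Finset.range N, a h * π ^ h) := by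
  have hstep : ∀ x : S, ∃ t ∈ T, ∃ y, x = t + π * y := by
    intro x
    obtain ⟨t, ht, hxt⟩ := hT x
    obtain ⟨y, hy⟩ := hdvd π (x - t) (by rw [hπ]; exact Order.one_le_iff_pos.2 hxt)
    exact ⟨t, ht, y, by rw [← hy]; ring⟩
  choose t ht y hy using hstep
  have key : ∀ N : ℕ, x - ∑ h ∈ Finset.range N, t (y^[h] x) * π ^ h = π ^ N * y^[N] x := by
    intro N
    induction N with
    | zero => simp
    | succ N ih =>
      rw [Finset.sum_range_succ, ← sub_sub, ih, Function.iterate_succ_apply']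
      conv_lhs => enter [1, 2]; rw [hy (y^[N] x)]
      ring
  refine ⟨fun h => t (y^[h] x), fun h => ht _, fun N => ?_⟩
  rw [key, v.map_mul, v.map_pow, hπ, nsmul_eq_mul, mul_one]
  exact le_self_add

/-! ### The additive valuation on the valuation ring -/

section ordInt

variable {K : Type*} [Field K] [Valued K ℤᵐ⁰]

theorem natCast_le_ordInt {x : K} (hx : (Valued.v x : ℤᵐ⁰) ≤ 1) (N : ℕ) :
    (N : ℕ∞) ≤ ordInt x ↔ (Valued.v x : ℤᵐ⁰) ≤ WithZero.exp (-(N : ℤ)) := by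
  unfold ordInt
  split_ifs with h
  · simp [h]
  · have h0 : (Valued.v x : ℤᵐ⁰) ≠ 0 := (Valuation.ne_zero_iff _).2 h
    have h1 : WithZero.log (Valued.v x : ℤᵐ⁰) ≤ 0 := by
      rwa [← WithZero.log_one, WithZero.log_le_log h0 one_ne_zero]
    rw [← WithZero.log_le_log h0 WithZero.exp_ne_zero, WithZero.log_exp, Nat.cast_le]
    omega

theorem ordInt_eq_of_map_eq {x : K} {N : ℕ}
    (hx : (Valued.v x : ℤᵐ⁰) = WithZero.exp (-(N : ℤ))) : ordInt x = N := by
  have h : x ≠ 0 := by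
    rintro rfl
    rw [map_zero] at hx
    exact WithZero.exp_ne_zero hx.symm
  rw [ordInt, if_neg h, hx, WithZero.log_exp]
  simp

theorem map_eq_exp_of_ordInt_eq {x : K} (hx : (Valued.v x : ℤᵐ⁰) ≤ 1) {N : ℕ}
    (h : ordInt x = N) : (Valued.v x : ℤᵐ⁰) = WithZero.exp (-(N : ℤ)) := by
  refine le_antisymm ((natCast_le_ordInt hx N).1 h.ge) ?_
  by_contra! hlt
  have h0 : x ≠ 0 := by
    rintro rfl
    simp [ordInt] at h
  have h0' : (Valued.v x : ℤᵐ⁰) ≠ 0 := (Valuation.ne_zero_iff _).2 h0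
  have h1 : (Valued.v x : ℤᵐ⁰) ≤ WithZero.exp (-((N + 1 : ℕ) : ℤ)) := by
    rw [← WithZero.log_lt_log h0' WithZero.exp_ne_zero, WithZero.log_exp] at hlt
    rw [← WithZero.log_le_log h0' WithZero.exp_ne_zero, WithZero.log_exp]
    push_cast
    omega
  have h2 := (natCast_le_ordInt hx (N + 1)).2 h1
  rw [h] at h2
  have h3 : N + 1 ≤ N := by exact_mod_cast h2
  omega

theorem exists_ordInt_eq_natCast {x : K} (hx : x ≠ 0) : ∃ a : ℕ, ordInt x = a :=
  ⟨_, by rw [ordInt, if_neg hx]⟩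

theorem ordInt_mul {x y : K} (hx : (Valued.v x : ℤᵐ⁰) ≤ 1) (hy : (Valued.v y : ℤᵐ⁰) ≤ 1) :
    ordInt (x * y) = ordInt x + ordInt y := by
  by_cases hx0 : x = 0
  · simp [hx0, ordInt]
  by_cases hy0 : y = 0
  · simp [hy0, ordInt]
  obtain ⟨a, ha⟩ := exists_ordInt_eq_natCast hx0
  obtain ⟨b, hb⟩ := exists_ordInt_eq_natCast hy0
  rw [ha, hb, ← Nat.cast_add]
  apply ordInt_eq_of_map_eq
  rw [map_mul, map_eq_exp_of_ordInt_eq hx ha, map_eq_exp_of_ordInt_eq hy hb, ← WithZero.exp_add]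
  congr 1
  push_cast
  ring

variable (K) in
/-- The normalized additive valuation on the valuation ring of `K`. -/
noncomputable def integerOrd : AddValuation (Valued.integer K) ℕ∞ :=
  AddValuation.of (fun x => ordInt (x : K))
    (by simp [ordInt])
    (by simp [ordInt])
    (fun x y => by
      refine ENat.forall_natCast_le_iff_le.1 fun N hN => ?_
      rw [le_min_iff, natCast_le_ordInt x.2, natCast_le_ordInt y.2] at hN
      rw [natCast_le_ordInt (x + y).2]
      exact Valuation.map_add_le _ hN.1 hN.2)
    (fun x y => ordInt_mul x.2 y.2)

theorem integerOrd_apply (x : Valued.integer K) : integerOrd K x = ordInt (x : K) := rfl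

theorem natCast_le_integerOrd (x : Valued.integer K) (N : ℕ) :
    (N : ℕ∞) ≤ integerOrd K x ↔ (Valued.v (x : K) : ℤᵐ⁰) ≤ WithZero.exp (-(N : ℤ)) :=
  natCast_le_ordInt x.2 N

theorem integerOrd_eq_top (x : Valued.integer K) (h : integerOrd K x = ⊤) : x = 0 := by
  rw [integerOrd_apply, ordInt] at h
  split_ifs at h with h0
  · exact Subtype.ext h0
  · exact absurd h (ENat.natCast_ne_top _)

theorem dvd_of_integerOrd_le (x y : Valued.integer K) (h : integerOrd K x ≤ integerOrd K y) :
    x ∣ y := by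
  rw [Valuation.Integers.dvd_iff_le (Valuation.integer.integers (Valued.v : Valuation K ℤᵐ⁰))]
  change (Valued.v (y : K) : ℤᵐ⁰) ≤ Valued.v (x : K)
  by_cases hx : (x : K) = 0
  · have : y = 0 := by
      apply integerOrd_eq_top
      rw [← top_le_iff]
      refine le_trans ?_ h
      rw [integerOrd_apply, ordInt, if_pos hx]
    simp [this]
  · obtain ⟨a, ha⟩ := exists_ordInt_eq_natCast hx
    rw [map_eq_exp_of_ordInt_eq x.2 ha]
    exact (natCast_le_ordInt y.2 a).1 (ha ▸ h)

theorem integerOrd_eq_zero_iff (x : Valued.integer K) :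
    integerOrd K x = 0 ↔ (Valued.v (x : K) : ℤᵐ⁰) = 1 := by
  change ordInt (x : K) = (0 : ℕ) ↔ _
  refine ⟨fun h => ?_, fun h => ordInt_eq_of_map_eq (by rw [h]; simp)⟩
  rw [map_eq_exp_of_ordInt_eq x.2 h]
  simp

theorem integerOrd_pos_iff (x : Valued.integer K) :
    0 < integerOrd K x ↔ IsLocalRing.residue (Valued.integer K) x = 0 := by
  rw [IsLocalRing.residue_eq_zero_iff, IsLocalRing.mem_maximalIdeal, mem_nonunits_iff,
    Valuation.Integers.isUnit_iff_valuation_eq_one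
      (Valuation.integer.integers (Valued.v : Valuation K ℤᵐ⁰)), pos_iff_ne_zero, not_iff_not]
  exact integerOrd_eq_zero_iff x

theorem integerOrd_sub_pos_iff (x y : Valued.integer K) :
    0 < integerOrd K (x - y) ↔
      IsLocalRing.residue (Valued.integer K) x = IsLocalRing.residue (Valued.integer K) y := by
  rw [integerOrd_pos_iff, map_sub, sub_eq_zero]

/-! ### Topology and additive valuation -/

theorem mem_nhds_iff_exists_nat (hnorm : Function.Surjective (Valued.v : Valuation K ℤᵐ⁰))
    {s : Set K} {x : K} :
    s ∈ nhds x ↔ ∃ N : ℕ, {y | (Valued.v (y - x) : ℤᵐ⁰) ≤ WithZero.exp (-(N : ℤ))} ⊆ s := by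
  rw [Valued.mem_nhds]
  constructor
  · rintro ⟨γ, hγ⟩
    set g := MonoidWithZeroHom.ValueGroup₀.embedding γ.1
    have hg : g ≠ 0 := (_root_.map_ne_zero _).2 γ.ne_zero
    refine ⟨(1 - WithZero.log g).toNat, fun y hy => hγ ?_⟩
    refine (Valuation.restrict_lt_iff_lt_embedding _).2 (lt_of_le_of_lt hy ?_)
    rw [← WithZero.log_lt_log WithZero.exp_ne_zero hg, WithZero.log_exp]
    omega
  · rintro ⟨N, hN⟩
    obtain ⟨z, hz⟩ := hnorm (WithZero.exp (-(N : ℤ)))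
    have hz0 : Valued.v.restrict z ≠ 0 := by
      rw [ne_eq, Valuation.restrict_eq_zero_iff, hz]
      exact WithZero.exp_ne_zero
    refine ⟨Units.mk0 _ hz0, fun y hy => hN ?_⟩
    have h1 := (Valuation.restrict_lt_iff _).1 hy
    rw [hz] at h1
    exact h1.le

theorem hasSum_iff_forall_nat (hnorm : Function.Surjective (Valued.v : Valuation K ℤᵐ⁰))
    {f : ℕ → K} (hf : ∀ h, (Valued.v (f h) : ℤᵐ⁰) ≤ WithZero.exp (-(h : ℤ))) {x : K} :
    HasSum f x ↔ ∀ N : ℕ,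
      (Valued.v (x - ∑ h ∈ Finset.range N, f h) : ℤᵐ⁰) ≤ WithZero.exp (-(N : ℤ)) := by
  have htail : ∀ (N : ℕ) (s : Finset ℕ), (∀ h ∈ s, N ≤ h) →
      (Valued.v (∑ h ∈ s, f h) : ℤᵐ⁰) ≤ WithZero.exp (-(N : ℤ)) := by
    intro N s hs
    refine Valuation.map_sum_le _ fun h hh => (hf h).trans ?_
    have := hs h hh
    rw [WithZero.exp_le_exp]
    omega
  constructor
  · intro hsum N
    have h1 := hsum.tendsto_sum_nat
    have h2 : {y | (Valued.v (y - x) : ℤᵐ⁰) ≤ WithZero.exp (-(N : ℤ))} ∈ nhds x :=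
      (mem_nhds_iff_exists_nat hnorm).2 ⟨N, subset_rfl⟩
    obtain ⟨M, hM⟩ := Filter.eventually_atTop.1 (h1.eventually h2)
    have h3 := hM (max M N) (le_max_left _ _)
    rw [← Finset.sum_range_add_sum_Ico f (le_max_right M N)] at h3
    have h4 : x - ∑ h ∈ Finset.range N, f h = ∑ h ∈ Finset.Ico N (max M N), f h -
        ((∑ h ∈ Finset.range N, f h + ∑ h ∈ Finset.Ico N (max M N), f h) - x) := by ring
    rw [h4]
    exact Valuation.map_sub_le _ (htail N _ fun h hh => (Finset.mem_Ico.1 hh).1) h3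
  · intro h
    rw [HasSum, SummationFilter.unconditional_filter, Filter.tendsto_def]
    intro U hU
    obtain ⟨N, hN⟩ := (mem_nhds_iff_exists_nat hnorm).1 hU
    rw [Filter.mem_atTop_sets]
    refine ⟨Finset.range N, fun s hs => hN ?_⟩
    change (Valued.v (∑ h ∈ s, f h - x) : ℤᵐ⁰) ≤ WithZero.exp (-(N : ℤ))
    rw [← Finset.sum_sdiff hs]
    have h4 : ∑ h ∈ s \ Finset.range N, f h + ∑ h ∈ Finset.range N, f h - x =
      ∑ h ∈ s \ Finset.range N, f h - (x - ∑ h ∈ Finset.range N, f h) := by ring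
    rw [h4]
    refine Valuation.map_sub_le _ (htail N _ fun i hi => ?_) (h N)
    simpa using (Finset.mem_sdiff.1 hi).2

/-- In a complete field, a sequence of integral elements with small differences has a limit. -/
theorem exists_limit (hnorm : Function.Surjective (Valued.v : Valuation K ℤᵐ⁰))
    (hK : CompleteSpace K) (f : ℕ → Valued.integer K)
    (hf : ∀ s : ℕ, (s : ℕ∞) + 1 ≤ integerOrd K (f (s + 1) - f s)) :
    ∃ y, ∀ s : ℕ, (s : ℕ∞) + 1 ≤ integerOrd K (y - f s) := by
  have hmono : ∀ s t : ℕ, s ≤ t → (s : ℕ∞) + 1 ≤ integerOrd K (f t - f s) := by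
    intro s t hst
    induction t, hst using Nat.le_induction with
    | base => simp
    | succ t hst ih =>
      rw [← sub_add_sub_cancel _ (f t)]
      refine AddValuation.map_le_add _ (le_trans ?_ (hf t)) ih
      gcongr
  have hcast : ∀ (s : ℕ) (x : Valued.integer K), (s : ℕ∞) + 1 ≤ integerOrd K x ↔
      (Valued.v (x : K) : ℤᵐ⁰) ≤ WithZero.exp (-((s + 1 : ℕ) : ℤ)) := fun s x => by
    rw [← natCast_le_integerOrd, Nat.cast_add, Nat.cast_one]
  have hcauchy : CauchySeq fun s => (f s : K) := by
    rw [CauchySeq, Valued.cauchy_iff]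
    refine ⟨Filter.map_neBot, fun γ => ?_⟩
    set g := MonoidWithZeroHom.ValueGroup₀.embedding γ.1
    have hg : g ≠ 0 := (_root_.map_ne_zero _).2 γ.ne_zero
    obtain ⟨N, hN⟩ : ∃ N : ℕ, WithZero.exp (-((N + 1 : ℕ) : ℤ)) < g := by
      refine ⟨(1 - WithZero.log g).toNat, ?_⟩
      rw [← WithZero.log_lt_log WithZero.exp_ne_zero hg, WithZero.log_exp]
      push_cast
      omega
    refine ⟨(fun s => (f s : K)) '' Set.Ici N, Filter.image_mem_map (Filter.mem_atTop N), ?_⟩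
    rintro _ ⟨s, hs, rfl⟩ _ ⟨t, ht, rfl⟩
    refine (Valuation.restrict_lt_iff_lt_embedding _).2 (lt_of_le_of_lt ?_ hN)
    have h1 := AddValuation.le_map_sub (hmono N t ht) (hmono N s hs)
    rw [sub_sub_sub_cancel_right, hcast] at h1
    exact h1
  obtain ⟨y, hy⟩ := cauchySeq_tendsto_of_complete hcauchy
  have hlim : ∀ s : ℕ, (Valued.v (y - f s) : ℤᵐ⁰) ≤ WithZero.exp (-((s + 1 : ℕ) : ℤ)) := by
    intro s
    have h2 : {z | (Valued.v (z - y) : ℤᵐ⁰) ≤ WithZero.exp (-((s + 1 : ℕ) : ℤ))} ∈ nhds y :=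
      (mem_nhds_iff_exists_nat hnorm).2 ⟨s + 1, subset_rfl⟩
    obtain ⟨M, hM⟩ := Filter.eventually_atTop.1 (hy.eventually h2)
    have h3 := hM (max M s) (le_max_left _ _)
    have h4 := (hcast s _).1 (hmono s _ (le_max_right M s))
    have h5 : y - (f s : K) = ((f (max M s) - f s : Valued.integer K) : K) -
        ((f (max M s) : K) - y) := by
      push_cast
      ring
    rw [h5]
    exact Valuation.map_sub_le _ h4 h3
  have hyint : (Valued.v y : ℤᵐ⁰) ≤ 1 := by
    have h1 : y = (y - f 0) + f 0 := by ring
    rw [h1]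
    refine Valuation.map_add_le _ ((hlim 0).trans ?_) (f 0).2
    rw [← WithZero.exp_zero, WithZero.exp_le_exp]
    simp
  exact ⟨⟨y, hyint⟩, fun s => (hcast s _).2 (hlim s)⟩

end ordInt

/-! ### Existence and uniqueness of Teichmüller representatives -/

section teichmuller

variable {p : ℕ} {K : Type*} [Field K] [Valued K ℤᵐ⁰]

theorem integerOrd_prime_ne_zero (hK : IsLocalField p K) :
    integerOrd K (p : Valued.integer K) ≠ 0 := by
  rw [← pos_iff_ne_zero, integerOrd_pos_iff, map_natCast]
  have := hK.charP
  exact CharP.cast_eq_zero (Valued.ResidueField K) p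

/-- Every residue has a lift with `p ^ s`-th roots for all `s`. -/
def HasTeichmuller (p : ℕ) (K : Type*) [Field K] [Valued K ℤᵐ⁰] : Prop :=
  ∀ x : Valued.integer K, ∃ t ∈ infinitePowers (Valued.integer K) p, 0 < integerOrd K (x - t)

variable [hp : Fact p.Prime]

/-- With `x_{s + 1} ^ p ≡ x_s`, the sequence `x_{i + s} ^ (p ^ s)` converges to a `p ^ i`-th root
of the limit for `i = 0`. -/
theorem IsLocalField.hasTeichmuller (hK : IsLocalField p K) : HasTeichmuller p K := by
  intro x
  have hvp := integerOrd_prime_ne_zero hK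
  have hroot : ∀ x : Valued.integer K, ∃ y, 0 < integerOrd K (y ^ p - x) := by
    intro x
    have := hK.charP
    have := hK.perfect
    have : ExpChar (Valued.ResidueField K) p := ExpChar.prime hp.out
    have : PerfectRing (Valued.ResidueField K) p := PerfectField.toPerfectRing p
    obtain ⟨b, hb⟩ := surjective_frobenius (Valued.ResidueField K) p
      (IsLocalRing.residue (Valued.integer K) x)
    obtain ⟨y, hy⟩ := IsLocalRing.residue_surjective b
    refine ⟨y, (integerOrd_sub_pos_iff _ _).2 ?_⟩
    rw [map_pow, hy, ← hb, frobenius_def]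
  choose r hr using hroot
  set u : ℕ → Valued.integer K := fun s => r^[s] x
  have hu : ∀ s, 0 < integerOrd K (u (s + 1) ^ p - u s) := by
    intro s
    simp only [u, Function.iterate_succ_apply']
    exact hr _
  have hlim : ∀ i, ∃ y, ∀ s : ℕ, (s : ℕ∞) + 1 ≤ integerOrd K (y - u (i + s) ^ p ^ s) := by
    intro i
    refine exists_limit hK.normalized hK.complete (fun s => u (i + s) ^ p ^ s) fun s => ?_
    rw [pow_succ', pow_mul]
    exact add_one_le_map_pow_prime_pow_sub hvp (hu (i + s)) s
  choose y hy using hlim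
  refine ⟨y 0, fun i => ⟨y i, ?_⟩, ?_⟩
  · refine sub_eq_zero.1 (integerOrd_eq_top _ (ENat.eq_top_iff_forall_ge.2 fun s => ?_))
    have h1 := hy 0 (i + s)
    have h2 : (s : ℕ∞) ≤ integerOrd K (y i ^ p ^ i - (u (i + s) ^ p ^ s) ^ p ^ i) := by
      obtain ⟨w, hw⟩ := sub_dvd_pow_sub_pow (y i) (u (i + s) ^ p ^ s) (p ^ i)
      rw [hw, AddValuation.map_mul]
      exact le_self_add.trans ((hy i s).trans le_self_add)
    rw [zero_add] at h1
    rw [← pow_mul, ← pow_add, add_comm s i] at h2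
    rw [← sub_sub_sub_cancel_right _ _ (u (i + s) ^ p ^ (i + s))]
    refine AddValuation.le_map_sub h2 (le_trans ?_ h1)
    push_cast
    exact le_add_self.trans le_self_add
  · have h1 := hy 0 0
    rw [AddValuation.map_sub_swap]
    simp only [add_zero, pow_zero, pow_one, Nat.cast_zero, zero_add] at h1
    exact Order.one_le_iff_pos.1 h1

theorem mem_teichmullerReps_iff (hvp : integerOrd K (p : Valued.integer K) ≠ 0)
    (hT : HasTeichmuller p K) {x : K} :
    x ∈ teichmullerReps K ↔ ∃ t ∈ infinitePowers (Valued.integer K) p, (t : K) = x := by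
  constructor
  · rintro ⟨τ, hτ, a, rfl⟩
    refine ⟨τ a, fun s => ?_, rfl⟩
    obtain ⟨x, rfl⟩ := IsLocalRing.residue_surjective a
    obtain ⟨t, ht, hxt⟩ := hT x
    obtain ⟨y, rfl⟩ := ht s
    refine ⟨τ (IsLocalRing.residue _ y), ?_⟩
    rw [(integerOrd_sub_pos_iff _ _).1 hxt, map_pow, map_pow]
  · rintro ⟨t, ht, rfl⟩
    have hex : ∀ a : Valued.ResidueField K, ∃ t ∈ infinitePowers (Valued.integer K) p,
        IsLocalRing.residue (Valued.integer K) t = a := by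
      intro a
      obtain ⟨x, rfl⟩ := IsLocalRing.residue_surjective a
      obtain ⟨t, ht, hxt⟩ := hT x
      exact ⟨t, ht, ((integerOrd_sub_pos_iff _ _).1 hxt).symm⟩
    have huniq : ∀ t ∈ infinitePowers (Valued.integer K) p,
        ∀ t' ∈ infinitePowers (Valued.integer K) p,
        IsLocalRing.residue (Valued.integer K) t = IsLocalRing.residue (Valued.integer K) t' →
          t = t' := fun t ht t' ht' h =>
      eq_of_mem_infinitePowers hvp integerOrd_eq_top ht ht' ((integerOrd_sub_pos_iff _ _).2 h)
    choose τ hτ hres using hex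
    refine ⟨⟨⟨τ, ?_⟩, ?_⟩, hres, IsLocalRing.residue _ t, ?_⟩
    · exact huniq _ (hτ _) _ (one_mem _) (by rw [hres, map_one])
    · intro a b
      exact huniq _ (hτ _) _ (mul_mem (hτ _) (hτ _)) (by rw [hres, map_mul, hres, hres])
    · exact congrArg _ (huniq _ (hτ _) _ ht (hres _))

end teichmuller

/-! ### Totally ramified extensions -/

section ramified

variable {K L : Type*} [Field K] [Valued K ℤᵐ⁰] [Field L] [Valued L ℤᵐ⁰] [Algebra K L]

theorem IsTotallyRamified.map_le_one (h : IsTotallyRamified K L) {x : K}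
    (hx : (Valued.v x : ℤᵐ⁰) ≤ 1) : (Valued.v (algebraMap K L x) : ℤᵐ⁰) ≤ 1 := by
  rw [h.map_eq]
  exact pow_le_one' hx _

theorem isTotallyRamified_self (h : Function.Surjective (Valued.v : Valuation K ℤᵐ⁰)) :
    IsTotallyRamified K K :=
  ⟨h, fun x => by simp⟩

theorem IsTotallyRamified.trans {M : Type*} [Field M] [Valued M ℤᵐ⁰] [Algebra L M] [Algebra K M]
    [IsScalarTower K L M] (h : IsTotallyRamified K L) (h' : IsTotallyRamified L M) :
    IsTotallyRamified K M :=
  ⟨h'.normalized, fun x => by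
    rw [IsScalarTower.algebraMap_apply K L M, h'.map_eq, h.map_eq, ← pow_mul,
      Module.finrank_mul_finrank K L M]⟩

/-- The inclusion of the valuation rings of a totally ramified extension. -/
def IsTotallyRamified.integerMap (h : IsTotallyRamified K L) :
    Valued.integer K →+* Valued.integer L :=
  ((algebraMap K L).comp (Valued.integer K).subtype).codRestrict (Valued.integer L)
    fun x => h.map_le_one x.2

theorem IsTotallyRamified.coe_integerMap (h : IsTotallyRamified K L) (x : Valued.integer K) :
    (h.integerMap x : L) = algebraMap K L x := rfl

theorem IsTotallyRamified.integerOrd_integerMap [FiniteDimensional K L]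
    (h : IsTotallyRamified K L) (x : Valued.integer K) :
    integerOrd L (h.integerMap x) = Module.finrank K L * integerOrd K x := by
  have hn : Module.finrank K L ≠ 0 := Module.finrank_pos.ne'
  by_cases hx : x = 0
  · rw [hx, map_zero, AddValuation.map_zero, AddValuation.map_zero,
      ENat.mul_top (by exact_mod_cast hn)]
  · obtain ⟨a, ha⟩ := exists_ordInt_eq_natCast (x := (x : K)) fun h => hx (Subtype.ext h)
    rw [integerOrd_apply, integerOrd_apply, ha, ← Nat.cast_mul]
    apply ordInt_eq_of_map_eq
    rw [h.coe_integerMap, h.map_eq, map_eq_exp_of_ordInt_eq x.2 ha, ← WithZero.exp_nsmul]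
    congr 1
    simp

theorem IsUnif.map_le_one {π : K} (hπ : IsUnif π) : (Valued.v π : ℤᵐ⁰) ≤ 1 := by
  rw [hπ, ← WithZero.exp_zero, WithZero.exp_le_exp]
  simp

theorem IsUnif.ne_zero {π : K} (hπ : IsUnif π) : π ≠ 0 := by
  rintro rfl
  rw [IsUnif, map_zero] at hπ
  exact WithZero.exp_ne_zero hπ.symm

theorem IsUnif.ordInt_eq {π : K} (hπ : IsUnif π) : ordInt π = 1 := by
  have := ordInt_eq_of_map_eq (x := π) (N := 1) (by rw [hπ]; simp)
  simpa using this

theorem IsTotallyRamified.map_mul_pow_le (h : IsTotallyRamified K L) {π : L} (hπ : IsUnif π)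
    {x : K} (hx : (Valued.v x : ℤᵐ⁰) ≤ 1) (i : ℕ) :
    (Valued.v (algebraMap K L x * π ^ i) : ℤᵐ⁰) ≤ WithZero.exp (-(i : ℤ)) := by
  rw [map_mul, map_pow, hπ]
  refine (mul_le_mul' (h.map_le_one hx) le_rfl).trans ?_
  rw [one_mul, ← WithZero.exp_nsmul, WithZero.exp_le_exp]
  simp

/-- The terms of a sum `∑ c_i π ^ i` with `i < [L : K]` have distinct valuations, so that none of
them is larger than the sum. -/
theorem IsTotallyRamified.map_term_le_map_sum [FiniteDimensional K L] (h : IsTotallyRamified K L)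
    {π : L} (hπ : IsUnif π) (c : Fin (Module.finrank K L) → K) (i : Fin (Module.finrank K L)) :
    (Valued.v (c i • π ^ (i : ℕ)) : ℤᵐ⁰) ≤ Valued.v (∑ i, c i • π ^ (i : ℕ)) := by
  set f : Fin (Module.finrank K L) → L := fun i => c i • π ^ (i : ℕ)
  obtain ⟨i₀, -, hmax⟩ := Finset.exists_max_image Finset.univ
    (fun i => (Valued.v (f i) : ℤᵐ⁰)) ⟨i, Finset.mem_univ i⟩
  refine (hmax i (Finset.mem_univ i)).trans ?_
  by_cases h0 : (Valued.v (f i₀) : ℤᵐ⁰) = 0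
  · rw [h0]; exact zero_le
  have hval : ∀ i, c i ≠ 0 → (Valued.v (f i) : ℤᵐ⁰) =
      WithZero.exp (Module.finrank K L * WithZero.log (Valued.v (c i) : ℤᵐ⁰) - (i : ℤ)) := by
    intro i hi
    have h1 : (Valued.v (c i) : ℤᵐ⁰) ≠ 0 := (Valuation.ne_zero_iff _).2 hi
    simp only [f]
    rw [Algebra.smul_def, map_mul, h.map_eq, map_pow, hπ]
    conv_lhs => rw [← WithZero.exp_log h1]
    rw [← WithZero.exp_nsmul, ← WithZero.exp_nsmul, ← WithZero.exp_add]
    congr 1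
    simp
    ring
  refine le_of_eq (Valuation.map_sum_eq_of_lt _ (Finset.mem_univ i₀) ?_).symm
  intro i hi
  have hne : i ≠ i₀ := by simpa using hi
  refine lt_of_le_of_ne (hmax i (Finset.mem_univ i)) fun heq => hne ?_
  have hc₀ : c i₀ ≠ 0 := by
    rintro hc
    simp [f, hc] at h0
  have hc : c i ≠ 0 := by
    rintro hc
    rw [← heq] at h0
    simp [f, hc] at h0
  rw [hval i hc, hval i₀ hc₀, WithZero.exp_inj] at heq
  have h2 : (Module.finrank K L : ℤ) ∣ (i : ℤ) - (i₀ : ℤ) :=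
    ⟨WithZero.log (Valued.v (c i) : ℤᵐ⁰) - WithZero.log (Valued.v (c i₀) : ℤᵐ⁰), by linarith⟩
  have h3 := Int.eq_zero_of_abs_lt_dvd h2 (by rw [abs_lt]; omega)
  exact Fin.ext (by omega)

/-- A totally ramified extension does not extend the residue field: the powers `π ^ i`,
`i < [L : K]`, are a basis, and the coefficients of integral elements are integral. -/
theorem IsTotallyRamified.exists_integerMap_sub_pos [FiniteDimensional K L]
    (h : IsTotallyRamified K L) (x : Valued.integer L) :
    ∃ c : Valued.integer K, 0 < integerOrd L (x - h.integerMap c) := by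
  obtain ⟨π, hπ⟩ := h.normalized (WithZero.exp (-1 : ℤ))
  have hπ0 : π ≠ 0 := IsUnif.ne_zero hπ
  have hpos : 0 < Module.finrank K L := Module.finrank_pos
  have hli : LinearIndependent K fun i : Fin (Module.finrank K L) => π ^ (i : ℕ) := by
    rw [Fintype.linearIndependent_iff]
    intro c hc i
    have h1 := h.map_term_le_map_sum hπ c i
    rw [hc, map_zero] at h1
    have h2 := (Valuation.zero_iff _).1 (le_antisymm h1 zero_le)
    exact (smul_eq_zero.1 h2).resolve_right (pow_ne_zero _ hπ0)
  have hspan := hli.span_eq_top_of_card_eq_finrank' (by simp)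
  obtain ⟨c, hc⟩ := (Submodule.mem_span_range_iff_exists_fun K).1
    (hspan ▸ Submodule.mem_top : (x : L) ∈ Submodule.span K (Set.range fun i :
      Fin (Module.finrank K L) => π ^ (i : ℕ)))
  have hint : ∀ i, (Valued.v (c i) : ℤᵐ⁰) ≤ 1 := by
    intro i
    by_contra! hgt
    have h0 : (Valued.v (c i) : ℤᵐ⁰) ≠ 0 := (zero_lt_one.trans hgt).ne'
    have h1 := (h.map_term_le_map_sum hπ c i).trans (hc ▸ x.2)
    rw [Algebra.smul_def, map_mul, h.map_eq, map_pow, hπ, ← WithZero.exp_log h0,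
      ← WithZero.exp_nsmul, ← WithZero.exp_nsmul, ← WithZero.exp_add, ← WithZero.exp_zero,
      WithZero.exp_le_exp] at h1
    rw [← WithZero.exp_log h0, ← WithZero.exp_zero, WithZero.exp_lt_exp] at hgt
    have h2 : (Module.finrank K L : ℤ) * 1 ≤
        Module.finrank K L * WithZero.log (Valued.v (c i) : ℤᵐ⁰) :=
      mul_le_mul_of_nonneg_left (by omega) (by omega)
    simp only [nsmul_eq_mul, mul_neg, mul_one] at h1 h2
    omega
  refine ⟨⟨c ⟨0, hpos⟩, hint _⟩, ?_⟩
  rw [← Order.one_le_iff_pos]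
  refine (natCast_le_integerOrd _ 1).2 ?_
  have h1 : ((x - h.integerMap ⟨c ⟨0, hpos⟩, hint _⟩ : Valued.integer L) : L) =
      ∑ i ∈ Finset.univ.erase (⟨0, hpos⟩ : Fin (Module.finrank K L)), c i • π ^ (i : ℕ) := by
    have h2 := Finset.add_sum_erase Finset.univ
      (fun i : Fin (Module.finrank K L) => c i • π ^ (i : ℕ)) (Finset.mem_univ ⟨0, hpos⟩)
    simp only [pow_zero] at h2
    rw [hc] at h2
    rw [AddSubgroupClass.coe_sub, h.coe_integerMap, ← h2, Algebra.smul_def]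
    simp
  rw [h1]
  refine Valuation.map_sum_le _ fun i hi => ?_
  have hi0 : (i : ℕ) ≠ 0 := fun h0 => (Finset.ne_of_mem_erase hi) (Fin.ext h0)
  rw [Algebra.smul_def, map_mul, map_pow, hπ]
  refine (mul_le_mul' (h.map_le_one (hint i)) le_rfl).trans ?_
  rw [one_mul, ← WithZero.exp_nsmul, WithZero.exp_le_exp]
  simp
  omega

end ramified

/-! ### Teichmüller expansions of uniformizers -/

section expansion

variable {p : ℕ}

/-- The properties of local fields that are needed for expansions with Teichmüller coefficients:
the valuation is normalized, `p` has positive valuation, and all residues have Teichmüller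
representatives. Completeness is not required, and the properties pass to totally ramified
extensions. -/
structure HasTeichmullerExpansions (p : ℕ) (K : Type*) [Field K] [Valued K ℤᵐ⁰] : Prop where
  normalized : Function.Surjective (Valued.v : Valuation K ℤᵐ⁰)
  prime : integerOrd K (p : Valued.integer K) ≠ 0
  exists_rep : HasTeichmuller p K

theorem IsLocalField.hasTeichmullerExpansions [Fact p.Prime] {K : Type*} [Field K] [Valued K ℤᵐ⁰]
    (hK : IsLocalField p K) : HasTeichmullerExpansions p K :=
  ⟨hK.normalized, integerOrd_prime_ne_zero hK, hK.hasTeichmuller⟩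

theorem map_le_one_of_mem_teichmullerReps {K : Type*} [Field K] [Valued K ℤᵐ⁰] {x : K}
    (hx : x ∈ teichmullerReps K) :
    (Valued.v x : ℤᵐ⁰) ≤ 1 := by
  obtain ⟨τ, -, a, rfl⟩ := hx
  exact (τ a).2

variable {K L : Type*} [Field K] [Valued K ℤᵐ⁰] [Field L] [Valued L ℤᵐ⁰] [Algebra K L]

/-- At the first place where two expansions differ, the difference of the coefficients is a unit,
because distinct Teichmüller representatives have distinct residues. -/
theorem isTeichmullerExpansion_unique [hp : Fact p.Prime] (hK : HasTeichmullerExpansions p K)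
    (h : IsTotallyRamified K L) {πK : K} {πL : L} (hπL : IsUnif πL) {a b : ℕ → K}
    (ha : IsTeichmullerExpansion πK πL a) (hb : IsTeichmullerExpansion πK πL b) : a = b := by
  set n := Module.finrank K L
  by_contra hne
  have hex : ∃ i, a i ≠ b i := Function.ne_iff.1 hne
  classical
  set i := Nat.find hex
  have hi : a i ≠ b i := Nat.find_spec hex
  have hmin : ∀ i' < i, a i' = b i' := fun i' hi' => not_not.1 (Nat.find_min hex hi')
  have hint : ∀ i, (Valued.v (a i - b i) : ℤᵐ⁰) ≤ 1 := fun i =>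
    Valuation.map_sub_le _ (map_le_one_of_mem_teichmullerReps (ha.1 i))
      (map_le_one_of_mem_teichmullerReps (hb.1 i))
  set f : ℕ → L := fun i => algebraMap K L (a i - b i) * πL ^ (i + n)
  have hf : ∀ i, (Valued.v (f i) : ℤᵐ⁰) ≤ WithZero.exp (-((i + n : ℕ) : ℤ)) := fun i =>
    h.map_mul_pow_le hπL (hint i) (i + n)
  have hsum : HasSum f 0 := by
    have h1 := ha.2.sub hb.2
    rw [sub_self] at h1
    have hfsub : f = fun i => algebraMap K L (a i) * πL ^ (i + n) -
        algebraMap K L (b i) * πL ^ (i + n) := by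
      funext i
      simp only [f]
      rw [map_sub, sub_mul]
    rw [hfsub]
    exact h1
  have h1 := (hasSum_iff_forall_nat h.normalized (fun i => (hf i).trans (by
    rw [WithZero.exp_le_exp]; omega))).1 hsum (i + 1 + n)
  have h2 : (Valued.v (f i) : ℤᵐ⁰) ≤ WithZero.exp (-((i + 1 + n : ℕ) : ℤ)) := by
    rw [zero_sub, Valuation.map_neg,
      ← Finset.sum_range_add_sum_Ico f (by omega : i + 1 ≤ i + 1 + n),
      Finset.sum_range_succ, Finset.sum_eq_zero, zero_add] at h1
    · rw [← add_sub_cancel_right (f i) (∑ k ∈ Finset.Ico (i + 1) (i + 1 + n), f k)]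
      refine Valuation.map_sub_le _ h1 (Valuation.map_sum_le _ fun k hk => (hf k).trans ?_)
      have := (Finset.mem_Ico.1 hk).1
      rw [WithZero.exp_le_exp]
      omega
    · intro k hk
      simp only [f]
      rw [hmin k (Finset.mem_range.1 hk), sub_self, map_zero, zero_mul]
  refine hi ?_
  obtain ⟨s, hs, hsa⟩ := (mem_teichmullerReps_iff hK.prime hK.exists_rep).1 (ha.1 i)
  obtain ⟨t, ht, htb⟩ := (mem_teichmullerReps_iff hK.prime hK.exists_rep).1 (hb.1 i)
  rw [← hsa, ← htb]
  refine congrArg _ (eq_of_mem_infinitePowers hK.prime integerOrd_eq_top hs ht ?_)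
  rw [pos_iff_ne_zero]
  intro h0
  have h3 : (Valued.v (a i - b i) : ℤᵐ⁰) = 1 := by
    rw [← hsa, ← htb]
    exact (integerOrd_eq_zero_iff (s - t)).1 h0
  simp only [f] at h2
  rw [map_mul, h.map_eq, h3, one_pow, one_mul, map_pow, hπL, ← WithZero.exp_nsmul,
    WithZero.exp_le_exp] at h2
  simp at h2

/-- The closed form of the indices of inseparability. -/
theorem indexInsep_eq_gap [hp : Fact p.Prime] (hK : HasTeichmullerExpansions p K)
    (h : IsTotallyRamified K L) {πK : K} {πL : L} (hπL : IsUnif πL) {a : ℕ → K}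
    (ha : IsTeichmullerExpansion πK πL a) (ha0 : a 0 ≠ 0) {j : ℕ}
    (hj : j ≤ padicValNat p (Module.finrank K L)) :
    indexInsep p πK πL j =
      gap p (Module.finrank K L) (ordInt (p : L)) {i | a i ≠ 0} j := by
  have h1 : indexTilde p πK πL = fun j =>
      ⨅ i ∈ {i | padicValNat p (i + Module.finrank K L) ≤ j ∧ i ∈ {i | a i ≠ 0}}, (i : ℕ∞) := by
    funext j
    have h2 : ∀ i, (∃ a : ℕ → K, IsTeichmullerExpansion πK πL a ∧ a i ≠ 0) ↔ a i ≠ 0 := fun i =>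
      ⟨fun ⟨b, hb, hbi⟩ => isTeichmullerExpansion_unique hK h hπL hb ha ▸ hbi,
        fun hai => ⟨a, ha, hai⟩⟩
    simp only [indexTilde, h2]
    rfl
  rw [indexInsep, h1, downRec_eq_gap (A := {i | a i ≠ 0}) ha0 _ (Nat.sub_le _ _)]
  congr 1
  omega

variable [FiniteDimensional K L]

/-- The Teichmüller representatives of `K` represent all residues of `L`. -/
theorem HasTeichmullerExpansions.exists_integerMap_rep (hK : HasTeichmullerExpansions p K)
    (h : IsTotallyRamified K L) (x : Valued.integer L) :
    ∃ t ∈ h.integerMap '' infinitePowers (Valued.integer K) p, 0 < integerOrd L (x - t) := by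
  obtain ⟨c, hc⟩ := h.exists_integerMap_sub_pos x
  obtain ⟨t, ht, hct⟩ := hK.exists_rep c
  refine ⟨_, ⟨t, ht, rfl⟩, ?_⟩
  rw [← sub_add_sub_cancel x (h.integerMap c), ← Order.one_le_iff_pos]
  refine AddValuation.map_le_add _ (Order.one_le_iff_pos.2 hc) ?_
  rw [← map_sub, h.integerOrd_integerMap, Order.one_le_iff_ne_zero]
  exact mul_ne_zero (by exact_mod_cast (Module.finrank_pos (R := K) (M := L)).ne') hct.ne'

theorem HasTeichmullerExpansions.of_isTotallyRamified (hK : HasTeichmullerExpansions p K)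
    (h : IsTotallyRamified K L) : HasTeichmullerExpansions p L := by
  refine ⟨h.normalized, ?_, fun x => ?_⟩
  · have h1 := h.integerOrd_integerMap (p : Valued.integer K)
    rw [map_natCast] at h1
    rw [h1]
    exact mul_ne_zero (by exact_mod_cast (Module.finrank_pos (R := K) (M := L)).ne') hK.prime
  · obtain ⟨_, ⟨t, ht, rfl⟩, hxt⟩ := hK.exists_integerMap_rep h x
    exact ⟨_, map_mem_infinitePowers p h.integerMap ht, hxt⟩

variable [hp : Fact p.Prime]

/-- The expansion of `πK` is `πL ^ n` times the digit expansion of the unit `πK / πL ^ n`. -/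
theorem exists_isTeichmullerExpansion (hK : HasTeichmullerExpansions p K)
    (h : IsTotallyRamified K L) {πK : K} {πL : L} (hπK : IsUnif πK) (hπL : IsUnif πL) :
    ∃ a : ℕ → K, IsTeichmullerExpansion πK πL a ∧ a 0 ≠ 0 := by
  set n := Module.finrank K L
  have hval : (Valued.v (algebraMap K L πK / πL ^ n) : ℤᵐ⁰) = 1 := by
    rw [map_div₀, h.map_eq, map_pow, hπK, hπL]
    exact div_self (pow_ne_zero _ WithZero.exp_ne_zero)
  set u : Valued.integer L := ⟨algebraMap K L πK / πL ^ n, hval.le⟩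
  have hu0 : integerOrd L u = 0 := (integerOrd_eq_zero_iff u).2 hval
  set π : Valued.integer L := ⟨πL, hπL.map_le_one⟩
  obtain ⟨d, hd, hdN⟩ := exists_digits (v := integerOrd L) dvd_of_integerOrd_le
    (hK.exists_integerMap_rep h) (π := π) hπL.ordInt_eq u
  choose t ht htd using hd
  refine ⟨fun i => (t i : K), ⟨fun i => ?_, ?_⟩, fun h0 => ?_⟩
  · exact (mem_teichmullerReps_iff hK.prime hK.exists_rep).2 ⟨t i, ht i, rfl⟩
  · refine (hasSum_iff_forall_nat h.normalized fun i =>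
      (h.map_mul_pow_le hπL (t i).2 (i + n)).trans (by rw [WithZero.exp_le_exp]; omega)).2
      fun N => ?_
    have h1 := (natCast_le_integerOrd _ N).1 (hdN N)
    have h2 : algebraMap K L πK -
        ∑ i ∈ Finset.range N, algebraMap K L (t i : K) * πL ^ (i + n) =
        πL ^ n * ((u - ∑ i ∈ Finset.range N, d i * π ^ i : Valued.integer L) : L) := by
      have h3 : algebraMap K L πK = πL ^ n * (u : L) :=
        (mul_div_cancel₀ _ (pow_ne_zero _ hπL.ne_zero)).symm
      push_cast
      rw [mul_sub, ← h3, Finset.mul_sum]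
      congr 1
      refine Finset.sum_congr rfl fun i _ => ?_
      rw [← htd, h.coe_integerMap]
      change _ = πL ^ n * (_ * πL ^ i)
      ring
    rw [h2, map_mul]
    refine (mul_le_mul' ?_ h1).trans (one_mul _).le
    rw [map_pow]
    exact pow_le_one' hπL.map_le_one _
  · have h1 := hdN 1
    have h2 : d 0 = 0 := by
      have h3 : t 0 = 0 := Subtype.ext h0
      rw [← htd, h3, map_zero]
    simp [h2, hu0] at h1

end expansion

/-! ### Towers of totally ramified extensions -/

section towers

theorem ordInt_prime_algebraMap {p : ℕ} {K L : Type*} [Field K] [Field L] [Valued K ℤᵐ⁰]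
    [Valued L ℤᵐ⁰] [Algebra K L] [FiniteDimensional K L] (h : IsTotallyRamified K L) :
    ordInt (p : L) = Module.finrank K L * ordInt (p : K) := by
  have h1 := h.integerOrd_integerMap (p : Valued.integer K)
  rw [map_natCast] at h1
  exact h1

variable {p : ℕ} [hp : Fact p.Prime]

/-- The subring of the valuation ring that is generated by the Teichmüller representatives. -/
def teichmullerSubring (p : ℕ) (M : Type*) [Field M] [Valued M ℤᵐ⁰] : Subring (Valued.integer M) :=
  Subring.closure (infinitePowers (Valued.integer M) p : Set (Valued.integer M))

variable {K L M : Type*} [Field K] [Field L] [Field M]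
  [Valued K ℤᵐ⁰] [Valued L ℤᵐ⁰] [Valued M ℤᵐ⁰]
  [Algebra K L] [Algebra L M] [Algebra K M] [IsScalarTower K L M]
  [FiniteDimensional K L] [FiniteDimensional L M]

/-- The Teichmüller expansion of `πK` in terms of `πL`, seen in the valuation ring of an
extension `M` of `L`. -/
theorem exists_isUnitExpansion (hK : HasTeichmullerExpansions p K) (h : IsTotallyRamified K L)
    (h' : IsTotallyRamified L M) {πK : K} {πL : L} (hπK : IsUnif πK) (hπL : IsUnif πL)
    {κ ϖ : Valued.integer M} (hκ : (κ : M) = algebraMap K M πK)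
    (hϖ : (ϖ : M) = algebraMap L M πL) :
    ∃ a : ℕ → teichmullerSubring p M,
      IsUnitExpansion (integerOrd M) κ ϖ (Module.finrank K L) a ∧
        ∀ j ≤ padicValNat p (Module.finrank K L), indexInsep p πK πL j =
          gap p (Module.finrank K L) (ordInt (p : L)) {i | (a i : Valued.integer M) ≠ 0} j := by
  have hM := (hK.of_isTotallyRamified h).of_isTotallyRamified h'
  have h'' : IsTotallyRamified K M := h.trans h'
  obtain ⟨a, ha, ha0⟩ := exists_isTeichmullerExpansion hK h hπK hπL
  have hex : ∀ i, ∃ b ∈ infinitePowers (Valued.integer M) p, (b : M) = algebraMap K M (a i) := by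
    intro i
    obtain ⟨t, ht, hta⟩ := (mem_teichmullerReps_iff hK.prime hK.exists_rep).1 (ha.1 i)
    exact ⟨h''.integerMap t, map_mem_infinitePowers p _ ht, by rw [h''.coe_integerMap, hta]⟩
  choose b hb hba using hex
  have hb0 : ∀ i, b i = 0 ↔ a i = 0 := by
    intro i
    rw [← map_eq_zero_iff (algebraMap K M) (algebraMap K M).injective, ← hba i]
    exact ⟨fun h => by rw [h]; rfl, fun h => Subtype.ext h⟩
  refine ⟨fun i => ⟨b i, Subring.subset_closure (hb i)⟩, ⟨fun i => ?_, ?_, fun N => ?_⟩, ?_⟩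
  · exact eq_zero_or_map_eq_zero_of_mem_infinitePowers hM.prime integerOrd_eq_top (hb i)
  · exact fun h0 => ha0 ((hb0 0).1 h0)
  · rw [natCast_le_integerOrd, aeval_truncPoly]
    have h1 := (hasSum_iff_forall_nat h.normalized (fun i => (h.map_mul_pow_le hπL
      (map_le_one_of_mem_teichmullerReps (ha.1 i)) (i + Module.finrank K L)).trans (by
        rw [WithZero.exp_le_exp]; omega))).1 ha.2 N
    have h2 : ((κ - ∑ i ∈ Finset.range N, b i * ϖ ^ (i + Module.finrank K L) :
        Valued.integer M) : M) = algebraMap L M (algebraMap K L πK -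
          ∑ i ∈ Finset.range N, algebraMap K L (a i) * πL ^ (i + Module.finrank K L)) := by
      rw [AddSubgroupClass.coe_sub, AddSubmonoidClass.coe_finsetSum, map_sub, map_sum, hκ,
        IsScalarTower.algebraMap_apply K L M]
      congr 1
      refine Finset.sum_congr rfl fun i _ => ?_
      rw [map_mul, map_pow, ← IsScalarTower.algebraMap_apply K L M, ← hba, ← hϖ]
      rfl
    have h3 : WithZero.exp (-(N : ℤ)) ≤ (1 : ℤᵐ⁰) := by
      rw [← WithZero.exp_zero, WithZero.exp_le_exp]
      omega
    change (Valued.v ((κ - ∑ i ∈ Finset.range N, b i * ϖ ^ (i + Module.finrank K L) :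
        Valued.integer M) : M) : ℤᵐ⁰) ≤ _
    rw [h2, h'.map_eq]
    calc _ ≤ (WithZero.exp (-(N : ℤ)) : ℤᵐ⁰) ^ Module.finrank L M := pow_le_pow_left' h1 _
      _ ≤ _ := pow_le_of_le_one zero_le h3 Module.finrank_pos.ne'
  · intro j hj
    rw [indexInsep_eq_gap hK h hπL ha ha0 hj]
    congr 1
    ext i
    exact (not_congr (hb0 i)).symm

/-- The prime `p` is approximated by polynomials in a uniformizer of `K` with Teichmüller
coefficients. -/
theorem exists_polynomial_approx_prime (hK : HasTeichmullerExpansions p K)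
    (h : IsTotallyRamified K L) {πK : K} (hπK : IsUnif πK) {κ : Valued.integer L}
    (hκ : (κ : L) = algebraMap K L πK) (N : ℕ) :
    ∃ Q : (teichmullerSubring p L)[X], Q.coeff 0 = 0 ∧
      (N : ℕ∞) ≤ integerOrd L (p - aeval κ Q) := by
  rcases Nat.eq_zero_or_pos N with rfl | hN
  · exact ⟨0, by simp, by simp⟩
  set π : Valued.integer K := ⟨πK, hπK.map_le_one⟩
  have hκπ : κ = h.integerMap π := Subtype.ext hκ
  obtain ⟨d, hd, hdN⟩ := exists_digits (v := integerOrd K)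
    (T := infinitePowers (Valued.integer K) p)
    dvd_of_integerOrd_le (fun x => hK.exists_rep x) (π := π) hπK.ordInt_eq (p : Valued.integer K)
  have hd0 : d 0 = 0 := by
    refine eq_of_mem_infinitePowers hK.prime integerOrd_eq_top (hd 0) zero_mem_infinitePowers ?_
    have h1 := hdN 1
    rw [← Order.one_le_iff_pos]
    have h2 : d 0 - 0 = (p : Valued.integer K) - (p - ∑ i ∈ Finset.range 1, d i * π ^ i) := by
      simp
    rw [h2]
    exact AddValuation.le_map_sub (Order.one_le_iff_ne_zero.2 hK.prime) (by exact_mod_cast h1)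
  set b : ℕ → teichmullerSubring p L := fun i => ⟨h.integerMap (d i),
    Subring.subset_closure (map_mem_infinitePowers p h.integerMap (hd i))⟩
  refine ⟨truncPoly b 0 N, ?_, ?_⟩
  · rw [truncPoly, finsetSum_coeff]
    refine Finset.sum_eq_zero fun i _ => ?_
    rw [coeff_C_mul, coeff_X_pow]
    split_ifs with hi
    · have : i = 0 := by omega
      subst this
      rw [mul_one]
      exact Subtype.ext (by change h.integerMap (d 0) = 0; rw [hd0, map_zero])
    · rw [mul_zero]
  · have h1 : (p : Valued.integer L) - aeval κ (truncPoly b 0 N) =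
        h.integerMap (p - ∑ i ∈ Finset.range N, d i * π ^ i) := by
      rw [aeval_truncPoly, map_sub, map_natCast, map_sum, hκπ]
      congr 1
      refine Finset.sum_congr rfl fun i _ => ?_
      rw [map_mul, map_pow]
      rfl
    rw [h1, h.integerOrd_integerMap]
    refine (hdN N).trans ?_
    conv_lhs => rw [← one_mul (integerOrd K _)]
    gcongr
    exact_mod_cast Module.finrank_pos

/-- All the data of a tower, transported to the valuation ring of the top field. -/
theorem exists_tower_data (hK : HasTeichmullerExpansions p K) (h : IsTotallyRamified K L)
    (h' : IsTotallyRamified L M) {πK : K} {πL : L} {πM : M} (hπK : IsUnif πK) (hπL : IsUnif πL)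
    (hπM : IsUnif πM) :
    ∃ (π ϖ κ : Valued.integer M) (a b c : ℕ → teichmullerSubring p M),
      integerOrd M π = 1 ∧ integerOrd M ϖ = Module.finrank L M ∧
      (∀ N : ℕ, ∃ Q : (teichmullerSubring p M)[X], Q.coeff 0 = 0 ∧
        (N : ℕ∞) ≤ integerOrd M (p - aeval κ Q)) ∧
      IsUnitExpansion (integerOrd M) κ ϖ (Module.finrank K L) a ∧
      IsUnitExpansion (integerOrd M) ϖ π (Module.finrank L M) b ∧
      IsUnitExpansion (integerOrd M) κ π (Module.finrank K L * Module.finrank L M) c ∧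
      (∀ j ≤ padicValNat p (Module.finrank K L), indexInsep p πK πL j =
        gap p (Module.finrank K L) (Module.finrank K L * ordInt (p : K))
          {i | (a i : Valued.integer M) ≠ 0} j) ∧
      (∀ j ≤ padicValNat p (Module.finrank L M), indexInsep p πL πM j =
        gap p (Module.finrank L M) (Module.finrank L M * (Module.finrank K L * ordInt (p : K)))
          {i | (b i : Valued.integer M) ≠ 0} j) ∧
      (∀ j ≤ padicValNat p (Module.finrank K L * Module.finrank L M), indexInsep p πK πM j =
        gap p (Module.finrank K L * Module.finrank L M)
          (Module.finrank L M * (Module.finrank K L * ordInt (p : K)))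
          {i | (c i : Valued.integer M) ≠ 0} j) := by
  have : FiniteDimensional K M := FiniteDimensional.trans K L M
  have hL := hK.of_isTotallyRamified h
  have h'' : IsTotallyRamified K M := h.trans h'
  have hMM : IsTotallyRamified M M := isTotallyRamified_self h'.normalized
  set π : Valued.integer M := ⟨πM, hπM.map_le_one⟩
  set ϖ : Valued.integer M := h'.integerMap ⟨πL, hπL.map_le_one⟩
  set κ : Valued.integer M := h''.integerMap ⟨πK, hπK.map_le_one⟩
  obtain ⟨a, ha, ha'⟩ := exists_isUnitExpansion (κ := κ) (ϖ := ϖ) hK h h' hπK hπL rfl rfl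
  obtain ⟨b, hb, hb'⟩ := exists_isUnitExpansion (κ := ϖ) (ϖ := π) hL h' hMM hπL hπM rfl rfl
  obtain ⟨c, hc, hc'⟩ := exists_isUnitExpansion (κ := κ) (ϖ := π) hK h'' hMM hπK hπM rfl rfl
  rw [← Module.finrank_mul_finrank K L M] at hc hc'
  rw [ordInt_prime_algebraMap h] at ha'
  rw [ordInt_prime_algebraMap h', ordInt_prime_algebraMap h] at hb'
  rw [ordInt_prime_algebraMap h', ordInt_prime_algebraMap h] at hc'
  refine ⟨π, ϖ, κ, a, b, c, hπM.ordInt_eq, ?_,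
    exists_polynomial_approx_prime hK h'' hπK rfl, ha, hb, hc, ha', hb', hc'⟩
  simp only [ϖ]
  rw [h'.integerOrd_integerMap, integerOrd_apply, hπL.ordInt_eq, mul_one]

theorem indexInsep_antitone (hK : HasTeichmullerExpansions p K) (h : IsTotallyRamified K L)
    {πK : K} {πL : L} (hπK : IsUnif πK) (hπL : IsUnif πL) {j j' : ℕ} (hj : j ≤ j')
    (hj' : j' ≤ padicValNat p (Module.finrank K L)) :
    indexInsep p πK πL j' ≤ indexInsep p πK πL j := by
  obtain ⟨a, ha, ha0⟩ := exists_isTeichmullerExpansion hK h hπK hπL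
  rw [indexInsep_eq_gap hK h hπL ha ha0 hj', indexInsep_eq_gap hK h hπL ha ha0 (hj.trans hj')]
  exact gap_antitone hj

theorem indexInsep_eq_zero_iff (hK : HasTeichmullerExpansions p K) (h : IsTotallyRamified K L)
    {πK : K} {πL : L} (hπK : IsUnif πK) (hπL : IsUnif πL) {j : ℕ}
    (hj : j ≤ padicValNat p (Module.finrank K L)) :
    indexInsep p πK πL j = 0 ↔ j = padicValNat p (Module.finrank K L) := by
  obtain ⟨a, ha, ha0⟩ := exists_isTeichmullerExpansion hK h hπK hπL
  rw [indexInsep_eq_gap hK h hπL ha ha0 hj]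
  refine ⟨fun h0 => ?_, fun h0 => gap_eq_zero ha0 h0.ge⟩
  by_contra hne
  exact gap_ne_zero (hK.of_isTotallyRamified h).prime ⟨0, ha0⟩ (lt_of_le_of_ne hj hne) h0

/-- The lower bound for the tower, when the same uniformizer of `L` is used for `L / K` and
`M / L`. -/
theorem le_indexInsep_tower (hK : HasTeichmullerExpansions p K) (h : IsTotallyRamified K L)
    (h' : IsTotallyRamified L M) {πK : K} {πL : L} {πM : M} (hπK : IsUnif πK) (hπL : IsUnif πL)
    (hπM : IsUnif πM) {l : ℕ}
    (hl : l ≤ padicValNat p (Module.finrank K L) + padicValNat p (Module.finrank L M)) {β : ℕ∞}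
    (hβ : ∀ j ≤ padicValNat p (Module.finrank K L), ∀ k ≤ padicValNat p (Module.finrank L M),
      j + k ≤ l →
        β ≤ Module.finrank L M * indexInsep p πK πL j + (p : ℕ∞) ^ j * indexInsep p πL πM k) :
    β ≤ indexInsep p πK πM l := by
  obtain ⟨π, ϖ, κ, a, b, c, hπ, hϖ, hQ, ha, hb, hc, ha', hb', hc'⟩ :=
    exists_tower_data hK h h' hπK hπL hπM
  have hM := (hK.of_isTotallyRamified h).of_isTotallyRamified h'
  have hn : Module.finrank K L ≠ 0 := Module.finrank_pos.ne'
  have hm : Module.finrank L M ≠ 0 := Module.finrank_pos.ne'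
  have hp' : integerOrd M (p : Valued.integer M) =
      Module.finrank L M * (Module.finrank K L * ordInt (p : K)) := by
    rw [← ordInt_prime_algebraMap h, ← ordInt_prime_algebraMap h']
    rfl
  rw [← padicValNat.mul hn hm] at hl
  rw [hc' l hl]
  refine le_gap_tower dvd_of_integerOrd_le
    (exists_approx_prime_mul hM.prime integerOrd_eq_top hM.exists_rep) hQ hπ hϖ hn hm
    (e := ordInt (p : K)) hK.prime
    hp' ha hb hc hl fun j k hjk => ?_
  have h1 := hβ (min j _) (min_le_right _ _) (min k _) (min_le_right _ _) (by omega)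
  rw [ha' _ (min_le_right _ _), hb' _ (min_le_right _ _), gap_min ha.zero, gap_min hb.zero] at h1
  refine h1.trans ?_
  gcongr
  · exact_mod_cast hp.out.one_le
  · exact min_le_left _ _

/-- If `(j, k)` gives the only minimum on all levels up to `j + k`, the lower bound is attained at
`l = j + k`. -/
theorem indexInsep_tower_le (hK : HasTeichmullerExpansions p K) (h : IsTotallyRamified K L)
    (h' : IsTotallyRamified L M) {πK : K} {πL : L} {πM : M} (hπK : IsUnif πK) (hπL : IsUnif πL)
    (hπM : IsUnif πM) {j k : ℕ} (hj : j ≤ padicValNat p (Module.finrank K L))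
    (hk : k ≤ padicValNat p (Module.finrank L M))
    (hlt : ∀ j' ≤ padicValNat p (Module.finrank K L), ∀ k' ≤ padicValNat p (Module.finrank L M),
      j' + k' ≤ j + k → (j', k') ≠ (j, k) →
      Module.finrank L M * indexInsep p πK πL j + (p : ℕ∞) ^ j * indexInsep p πL πM k <
        Module.finrank L M * indexInsep p πK πL j' + (p : ℕ∞) ^ j' * indexInsep p πL πM k') :
    indexInsep p πK πM (j + k) ≤
      Module.finrank L M * indexInsep p πK πL j + (p : ℕ∞) ^ j * indexInsep p πL πM k := by
  obtain ⟨π, ϖ, κ, a, b, c, hπ, hϖ, hQ, ha, hb, hc, ha', hb', hc'⟩ :=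
    exists_tower_data hK h h' hπK hπL hπM
  have hM := (hK.of_isTotallyRamified h).of_isTotallyRamified h'
  have hn : Module.finrank K L ≠ 0 := Module.finrank_pos.ne'
  have hm : Module.finrank L M ≠ 0 := Module.finrank_pos.ne'
  have hp' : integerOrd M (p : Valued.integer M) =
      Module.finrank L M * (Module.finrank K L * ordInt (p : K)) := by
    rw [← ordInt_prime_algebraMap h, ← ordInt_prime_algebraMap h']
    rfl
  rw [hc' _ (by rw [padicValNat.mul hn hm]; omega), ha' j hj, hb' k hk]
  refine gap_tower_le dvd_of_integerOrd_le
    (exists_approx_prime_mul hM.prime integerOrd_eq_top hM.exists_rep) hQ hπ hϖ hn hm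
    (e := ordInt (p : K)) hK.prime
    hp' ha hb hc hj hk fun j' k' hjk hne => ?_
  have h1 := hlt (min j' _) (min_le_right _ _) (min k' _) (min_le_right _ _) (by omega) (by
    intro heq
    obtain ⟨h2, h3⟩ := Prod.mk.inj heq
    exact hne (Prod.ext (by simp only; omega) (by simp only; omega)))
  rw [ha' _ (min_le_right _ _), hb' _ (min_le_right _ _), gap_min ha.zero, gap_min hb.zero,
    ha' j hj, hb' k hk] at h1
  refine h1.trans_le ?_
  gcongr
  · exact_mod_cast hp.out.one_le
  · exact min_le_left _ _

/-- The indices of inseparability do not depend on the uniformizers: this is the lower bound for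
the towers `L / K / K` and `L / L / K`, in which one of the two steps is trivial. -/
theorem indexInsep_congr (hK : HasTeichmullerExpansions p K) (h : IsTotallyRamified K L)
    {πK πK' : K} {πL πL' : L} (hπK : IsUnif πK) (hπK' : IsUnif πK') (hπL : IsUnif πL)
    (hπL' : IsUnif πL') {l : ℕ} (hl : l ≤ padicValNat p (Module.finrank K L)) :
    indexInsep p πK πL l = indexInsep p πK' πL' l := by
  have hbot : ∀ {πK πK' : K} {πL : L}, IsUnif πK → IsUnif πK' → IsUnif πL →
      indexInsep p πK πL l ≤ indexInsep p πK' πL l := by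
    intro πK πK' πL hπK hπK' hπL
    refine le_indexInsep_tower hK (isTotallyRamified_self hK.normalized) h hπK' hπK hπL
      (by omega) fun j hj k hk hjk => ?_
    refine (indexInsep_antitone hK h hπK hπL (by omega : k ≤ l) hl).trans ?_
    rw [Module.finrank_self, padicValNat_one_right, Nat.le_zero] at hj
    rw [hj, pow_zero, one_mul]
    exact le_add_self
  have htop : ∀ {πK : K} {πL πL' : L}, IsUnif πK → IsUnif πL → IsUnif πL' →
      indexInsep p πK πL l ≤ indexInsep p πK πL' l := by
    intro πK πL πL' hπK hπL hπL'
    refine le_indexInsep_tower hK h (isTotallyRamified_self h.normalized) hπK hπL hπL'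
      (by omega) fun j hj k hk hjk => ?_
    refine (indexInsep_antitone hK h hπK hπL (by omega : j ≤ l) hl).trans ?_
    rw [Module.finrank_self, Nat.cast_one, one_mul]
    exact le_self_add
  exact le_antisymm ((hbot hπK hπK' hπL).trans (htop hπK' hπL hπL'))
    ((hbot hπK' hπK hπL').trans (htop hπK hπL' hπL))

end towers

/-! ### Uniqueness of the minimum -/

/-- On the lowest level `j + k = l₀` on which the minimum `β` is attained exactly once, the pair
attaining it is the only one on all levels up to `l₀`: another pair on a lower level can be moved
up to level `l₀` without increasing the value, raising `k` if possible, and raising `j` if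
`k = μ`. -/
theorem exists_strict_min_of_existsUnique {ν μ l m p : ℕ} {i i' : ℕ → ℕ∞} (hp : p ≠ 0)
    (hi : ∀ j j', j ≤ j' → j' ≤ ν → i j' ≤ i j) (hi' : ∀ k k', k ≤ k' → k' ≤ μ → i' k' ≤ i' k)
    (hi'0 : ∀ k ≤ μ, i' k = 0 ↔ k = μ) {β : ℕ∞} (hβtop : β ≠ ⊤)
    (hβ : ∀ j ≤ ν, ∀ k ≤ μ, j + k ≤ l → β ≤ m * i j + (p : ℕ∞) ^ j * i' k)
    (hex : ∃ l₀ ≤ l, ∃! x : ℕ × ℕ, x ∈ pairsΩ ν μ l₀ ∧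
      m * i x.1 + (p : ℕ∞) ^ x.1 * i' x.2 = β) :
    ∃ j ≤ ν, ∃ k ≤ μ, j + k ≤ l ∧ m * i j + (p : ℕ∞) ^ j * i' k = β ∧
      ∀ j' ≤ ν, ∀ k' ≤ μ, j' + k' ≤ j + k → (j', k') ≠ (j, k) →
        β < m * i j' + (p : ℕ∞) ^ j' * i' k' := by
  classical
  set l₀ := Nat.find hex
  obtain ⟨hl₀, ⟨j, k⟩, ⟨⟨hj, hk, hjk⟩, hval⟩, huniq⟩ := Nat.find_spec hex
  have hmin : ∀ l' < l₀, ¬ (l' ≤ l ∧ ∃! x : ℕ × ℕ, x ∈ pairsΩ ν μ l' ∧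
      m * i x.1 + (p : ℕ∞) ^ x.1 * i' x.2 = β) := fun l' hl' => Nat.find_min hex hl'
  simp only at hj hk hjk hval
  change j + k = l₀ at hjk
  change l₀ ≤ l at hl₀
  have huniq' : ∀ a ≤ ν, ∀ b ≤ μ, a + b = l₀ → m * i a + (p : ℕ∞) ^ a * i' b = β →
      a = j ∧ b = k := fun a ha b hb hab h =>
    Prod.mk.inj (huniq (a, b) ⟨⟨ha, hb, hab⟩, h⟩)
  have hcancel : ∀ a b b', b' ≤ μ → i' b = 0 → m * i a + (p : ℕ∞) ^ a * i' b = β →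
      m * i a + (p : ℕ∞) ^ a * i' b' = β → b' = μ := by
    intro a b b' hb' hb h1 h2
    rw [hb, mul_zero, add_zero] at h1
    have h3 : m * i a + (p : ℕ∞) ^ a * i' b' = m * i a + 0 := by rw [h2, add_zero, h1]
    have h4 := ENat.add_right_injective_of_ne_top (h1 ▸ hβtop) h3
    rw [mul_eq_zero] at h4
    exact (hi'0 b' hb').1 (h4.resolve_left (by exact_mod_cast pow_ne_zero a hp))
  have hshape : ∀ a ≤ ν, ∀ b ≤ μ, a + b < l₀ → m * i a + (p : ℕ∞) ^ a * i' b = β →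
      (a = j ∧ b < k) ∨ (b = μ ∧ k = μ ∧ a < j) := by
    intro a ha b hb hab h
    by_cases hup : l₀ - a ≤ μ
    · left
      have h1 : m * i a + (p : ℕ∞) ^ a * i' (l₀ - a) = β := by
        refine le_antisymm ?_ (hβ a ha _ hup (by omega))
        rw [← h]
        gcongr
        exact hi' _ _ (by omega) hup
      have := huniq' a ha _ hup (by omega) h1
      omega
    · right
      have h1 : m * i a + (p : ℕ∞) ^ a * i' μ = β := by
        refine le_antisymm ?_ (hβ a ha _ le_rfl (by omega))
        rw [← h]
        gcongr
        exact hi' _ _ hb le_rfl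
      have hμ : i' μ = 0 := (hi'0 μ le_rfl).2 rfl
      have hbμ : b = μ := hcancel a μ b hb hμ h1 h
      have h2 : m * i (l₀ - μ) + (p : ℕ∞) ^ (l₀ - μ) * i' μ = β := by
        refine le_antisymm ?_ (hβ _ (by omega) _ le_rfl (by omega))
        rw [← h1, hμ, mul_zero, mul_zero, add_zero, add_zero]
        gcongr
        exact hi _ _ (by omega) (by omega)
      have := huniq' _ (by omega) _ le_rfl (by omega) h2
      omega
  refine ⟨j, hj, k, hk, by omega, hval, fun a ha b hb hab hne => ?_⟩
  refine lt_of_le_of_ne (hβ a ha b hb (by omega)) fun heq => ?_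
  have heq := heq.symm
  rcases (hjk ▸ hab).lt_or_eq with hlt | heq'
  · refine hmin (a + b) hlt ⟨by omega, (a, b), ⟨⟨ha, hb, rfl⟩, heq⟩, ?_⟩
    rintro ⟨a', b'⟩ ⟨⟨ha', hb', hab'⟩, heq'⟩
    simp only at ha' hb' hab' heq'
    rcases hshape a ha b hb hlt heq with ⟨h1, h2⟩ | ⟨h1, h2, h3⟩ <;>
      rcases hshape a' ha' b' hb' (hab' ▸ hlt) heq' with ⟨h1', h2'⟩ | ⟨h1', h2', h3'⟩
    · exact Prod.ext (by simp only; omega) (by simp only; omega)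
    · have := hcancel j k b hb ((hi'0 k hk).2 h2') hval (h1 ▸ heq)
      omega
    · have := hcancel j k b' hb' ((hi'0 k hk).2 h2) hval (h1' ▸ heq')
      omega
    · exact Prod.ext (by simp only; omega) (by simp only; omega)
  · obtain ⟨rfl, rfl⟩ := huniq' a ha b hb heq' heq
    exact hne rfl

theorem mainTheorem4 (p : ℕ) [Fact p.Prime]
    {K L M : Type*} [Field K] [Field L] [Field M]
    [Valued K ℤᵐ⁰] [Valued L ℤᵐ⁰] [Valued M ℤᵐ⁰]
    [Algebra K L] [Algebra L M] [Algebra K M] [IsScalarTower K L M]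
    [FiniteDimensional K L] [FiniteDimensional L M]
    [Algebra.IsSeparable K L] [Algebra.IsSeparable L M]
    (hK : IsLocalField p K) (hLK : IsTotallyRamified K L) (hML : IsTotallyRamified L M)
    -- the indices of `L / K`, `M / L`, `M / K` may be computed with unrelated uniformizers
    (πK πK' : K) (πL πL' : L) (πM πM' : M)
    (hπK : IsUnif πK) (hπL : IsUnif πL) (hπL' : IsUnif πL') (hπM : IsUnif πM)
    (hπK' : IsUnif πK') (hπM' : IsUnif πM')
    (ν μ : ℕ) (hν : ν = padicValNat p (Module.finrank K L))
    (hμ : μ = padicValNat p (Module.finrank L M))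
    (f : ℕ × ℕ → ℕ∞)
    (hf : ∀ x, f x = (Module.finrank L M : ℕ∞) * indexInsep p πK πL x.1 +
      (p : ℕ∞) ^ x.1 * indexInsep p πL' πM x.2)
    (l : ℕ) (hl : l ≤ ν + μ) :
    minUpTo ν μ l f ≤ indexInsep p πK' πM' l ∧
      ((∃ l₀ ≤ l, ∃! x : ℕ × ℕ, x ∈ pairsΩ ν μ l₀ ∧ f x = minUpTo ν μ l f) →
        indexInsep p πK' πM' l = minUpTo ν μ l f) := by
  subst hν hμ
  have hK' := hK.hasTeichmullerExpansions
  have hL' := hK'.of_isTotallyRamified hLK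
  have hMK := hLK.trans hML
  have : FiniteDimensional K M := FiniteDimensional.trans K L M
  have hn : Module.finrank K L ≠ 0 := Module.finrank_pos.ne'
  have hm : Module.finrank L M ≠ 0 := Module.finrank_pos.ne'
  have hνμ : padicValNat p (Module.finrank K M) =
      padicValNat p (Module.finrank K L) + padicValNat p (Module.finrank L M) := by
    rw [← Module.finrank_mul_finrank K L M, padicValNat.mul hn hm]
  have hβ : ∀ j ≤ padicValNat p (Module.finrank K L), ∀ k ≤ padicValNat p (Module.finrank L M),
      j + k ≤ l →
        minUpTo (padicValNat p (Module.finrank K L)) (padicValNat p (Module.finrank L M)) l f ≤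
        Module.finrank L M * indexInsep p πK πL j + (p : ℕ∞) ^ j * indexInsep p πL' πM k := by
    intro j hj k hk hjk
    rw [← hf (j, k)]
    exact iInf₂_le (j, k) ⟨j + k, hjk, hj, hk, rfl⟩
  have hML' : ∀ k ≤ padicValNat p (Module.finrank L M),
      indexInsep p πL πM k = indexInsep p πL' πM k := fun k hk =>
    indexInsep_congr hL' hML hπL hπL' hπM hπM hk
  -- all indices may be computed with `πK`, `πL` and `πM`
  rw [indexInsep_congr hK' hMK hπK' hπK hπM' hπM (hl.trans hνμ.ge)]
  have hle : minUpTo (padicValNat p (Module.finrank K L)) (padicValNat p (Module.finrank L M)) l f ≤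
      indexInsep p πK πM l :=
    le_indexInsep_tower hK' hLK hML hπK hπL hπM hl fun j hj k hk hjk => by
      rw [hML' k hk]
      exact hβ j hj k hk hjk
  refine ⟨hle, fun hex => ?_⟩
  by_cases htop : minUpTo (padicValNat p (Module.finrank K L))
      (padicValNat p (Module.finrank L M)) l f = ⊤
  · rw [htop] at hle ⊢
    exact top_le_iff.1 hle
  refine le_antisymm ?_ hle
  simp only [hf] at hex
  obtain ⟨j, hj, k, hk, hjk, hval, hlt⟩ := exists_strict_min_of_existsUnique
    (NeZero.ne p) (fun j j' => indexInsep_antitone hK' hLK hπK hπL)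
    (fun k k' => indexInsep_antitone hL' hML hπL' hπM)
    (fun k => indexInsep_eq_zero_iff hL' hML hπL' hπM) htop hβ hex
  refine (indexInsep_antitone hK' hMK hπK hπM hjk (hl.trans hνμ.ge)).trans ?_
  rw [← hval, ← hML' k hk]
  refine indexInsep_tower_le hK' hLK hML hπK hπL hπM hj hk fun j' hj' k' hk' hjk' hne => ?_
  rw [hML' k hk, hML' k' hk', hval]
  exact hlt j' hj' k' hk' hjk' hne
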